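/- Throughout, $\Bbbk$ is a commutative ring and $H^\bullet(Z,\Bbbk)=\bigoplus_{n\ge 0}H^n(Z,\Bbbk)$ denotes the sheaf cohomology ring, under the cup product, of a topological space $Z$ with coefficients in the constant sheaf $\Bbbk$. **Setting.** Let $G$ be a topological group with subgroups $L,R,P,Q$ such that $R\subset P$ and $Q\subset P$. Let $X$ be a topological space with commuting continuous actions of $L$ on the left and of $R$ on the right, and let $Y$ be a topological space with a continuous left action of $Q$. Let $\alpha:X\to G$ be a continuous map such that $\alpha(lx)=l\alpha(x)$ and $\alpha(xr)=\alpha(x)r$ for all $l\in L$, $x\in X$, $r\in R$. Let $E$ be a topological space with a continuous left action of $G$ such that the quotient maps $E\to L\backslash E$, $E\to R\backslash E$, $E\to P\backslash E$ and $E\to Q\backslash E$ are universal principal bundles for the respective groups (that is, they are locally trivial principal bundles and $E$ is contractible). For a subgroup $K\subset G$ and a left $K$-space $Z$ put $Z\,{}_K\!\times E=K\backslash(Z\times E)$ (diagonal action), $H_K^\bullet(Z)=H^\bullet(Z\,{}_K\!\times E,\Bbbk)$ and $H_K^\bullet(\mathrm{pt})=H^\bullet(K\backslash E,\Bbbk)$.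 The canonical projection $\mathrm{can}:Z\,{}_K\!\times E\to K\backslash E$, $K(z,e)\mapsto Ke$, defines the canonical left action $am=\mathrm{can}^*(a)\cup m$ of $H_K^\bullet(\mathrm{pt})$ on $H_K^\bullet(Z)$. For a subgroup $M\subset G$ and a continuous $K$-equivariant map $C:Z\to G/M$, the map $v_C:Z\,{}_K\!\times E\to M\backslash E$, $K(z,e)\mapsto C(z)^{-1}e$, defines the right action $mb=m\cup v_C^*(b)$ of $H_M^\bullet(\mathrm{pt})$ on $H_K^\bullet(Z)$ twisted by $C$ (used when $E\to M\backslash E$ is also a universal principal $M$-bundle). Let $T=X\times_R P\times_Q Y$ be the quotient of $X\times P\times Y$ by the relation $(x,p,y)\sim(xr,r^{-1}pq,q^{-1}y)$ for $r\in R$, $q\in Q$, with classes $[x:p:y]$ and left $L$-action $l[x:p:y]=[lx:p:y]$. Let $A:X/R\to G/R$, $xR\mapsto\alpha(x)R$, let $\pi_R:R\backslash E\to P\backslash E$ and $\pi_Q:Q\backslash E\to P\backslash E$ be the natural maps, and let $$\phi:T\,{}_L\!\times E\to\big((X/R)\,{}_L\!\times E\big)\times\big(Y\,{}_Q\!\times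 E\big),\qquad L([x:p:y],e)\mapsto\big(L(xR,e),\,Q(y,p^{-1}\alpha(x)^{-1}e)\big).$$ Let $H_P^\bullet(\mathrm{pt})$ act on $H_L^\bullet(X/R)$ on the right by $ma=m\cup v_A^*\pi_R^*(a)$ and on $H_Q^\bullet(Y)$ on the left by $an=\mathrm{can}^*\pi_Q^*(a)\cup n$. The map $$\Theta:H_L^\bullet(X/R)\otimes_{\Bbbk}H_Q^\bullet(Y)\to H_L^\bullet(T),\qquad \Theta(m\otimes n)=\phi^*\big(\mathrm{pr}_1^*(m)\cup\mathrm{pr}_2^*(n)\big)$$ factors through a map $$\theta:H_L^\bullet(X/R)\otimes_{H_P^\bullet(\mathrm{pt})}H_Q^\bullet(Y)\to H_L^\bullet(T).$$ **Theorem.** 1. On the additive group $H_L^\bullet(X/R)\otimes_{H_P^\bullet(\mathrm{pt})}H_Q^\bullet(Y)$ there is exactly one biadditive multiplication such that $$(m\otimes n)(m'\otimes n')=(-1)^{ij}\,(m\cup m')\otimes(n\cup n')\qquad\text{for } n\in H_Q^i(Y),\ m'\in H_L^j(X/R)$$ and arbitrary $m\in H_L^\bullet(X/R)$, $n'\in H_Q^\bullet(Y)$.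 It makes this group a ring with unit $1\otimes 1$, and $\theta$ is a homomorphism of (unital) rings. 2. $\theta$ is a homomorphism of left $H_L^\bullet(\mathrm{pt})$-modules for the canonical actions, where $a(m\otimes n)=(am)\otimes n$ on the domain. 3. Let $M$ be a subgroup of $G$ such that $E\to M\backslash E$ is a universal principal $M$-bundle, and let $B:Y\to G/M$ be a $Q$-equivariant continuous map. Let $\alpha B:T\to G/M$ be the $L$-equivariant continuous map $[x:p:y]\mapsto\alpha(x)pB(y)$. Then $\theta$ is a homomorphism of right $H_M^\bullet(\mathrm{pt})$-modules, where $(m\otimes n)b=m\otimes(nb)$ on the domain with the action on $H_Q^\bullet(Y)$ twisted by $B$, and the action on the codomain is twisted by $\alpha B$. -/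

import Mathlib

open Topology TensorProduct DirectSum

/-! ## Sheaf cohomology of a topological space with coefficients in a constant sheaf

The cohomology ring `H^•(X, k)` is computed by the canonical (Godement) flabby cosimplicial
resolution of the constant sheaf `k_X`.  With `(𝒢 F)(U) = ∏_{x ∈ U} F_x`, a global section of
`𝒢^{n+1} k_X` is a family, indexed by `x₀ ∈ X`, of germs at `x₀` of families, indexed by `x₁`, of
germs at `x₁` ... of elements of the stalk `k` of `k_X` at `x_n`.  In other words
`Γ(X, 𝒢^{n+1} k_X)` is the quotient of the module of all functions `f : X^{n+1} → k` by
the submodule of those `f` such that for all `x₀`, for all `x₁` near `x₀`, for all `x₂` near `x₁`,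
..., for all `x_n` near `x_{n-1}` one has `f (x₀, ..., x_n) = 0`.  The differential is the
alternating sum of the maps that omit a variable, and the cup product is given by
`(f ∪ g)(x₀, ..., x_{p+q}) = f (x₀, ..., x_p) g (x_p, ..., x_{p+q})`. -/

namespace SheafCoh

/-- All functions of `n + 1` points of `X`. -/
abbrev Fn (k X : Type*) (n : ℕ) := (Fin (n + 1) → X) → k

/-- `Near n x P`: for all `t₀` near `x`, for all `t₁` near `t₀`, ...,
for all `t_{n-1}` near `t_{n-2}` one has `P (t₀, ..., t_{n-1})`. -/
def Near {X : Type*} [TopologicalSpace X] : (n : ℕ) → X → ((Fin n → X) → Prop) → Prop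
  | 0, _, P => P Fin.elim0
  | n + 1, x, P => ∀ᶠ y in 𝓝 x, Near n y (fun t => P (Fin.cons y t))

section near
variable {X Y : Type*} [TopologicalSpace X] [TopologicalSpace Y]

theorem Near.of_forall {n : ℕ} {x : X} {P : (Fin n → X) → Prop} (h : ∀ t, P t) :
    Near n x P := by
  induction n generalizing x with
  | zero => exact h _
  | succ n ih => exact Filter.Eventually.of_forall fun y => ih fun t => h _

theorem Near.mp {n : ℕ} {x : X} {P Q : (Fin n → X) → Prop} (hP : Near n x P)
    (h : Near n x (fun t => P t → Q t)) : Near n x Q := by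
  induction n generalizing x with
  | zero => exact h hP
  | succ n ih =>
    change ∀ᶠ y in 𝓝 x, _ at hP h
    change ∀ᶠ y in 𝓝 x, _
    filter_upwards [hP, h] with y h1 h2 using ih h1 h2

theorem Near.mono {n : ℕ} {x : X} {P Q : (Fin n → X) → Prop} (hP : Near n x P)
    (h : ∀ t, P t → Q t) : Near n x Q :=
  hP.mp (Near.of_forall h)

theorem Near.comp {n : ℕ} {x : X} (g : C(X, Y)) {P : (Fin n → Y) → Prop}
    (h : Near n (g x) P) : Near n x (fun t => P (g ∘ t)) := by
  induction n generalizing x with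
  | zero =>
    change P _ at h
    change P _
    convert h
  | succ n ih =>
    change ∀ᶠ y in 𝓝 (g x), _ at h
    change ∀ᶠ y in 𝓝 x, _
    filter_upwards [g.continuous.continuousAt.eventually h] with y hy
    refine (ih hy).mono fun t ht => ?_
    convert ht using 1
    ext i
    refine Fin.cases ?_ (fun j => ?_) i <;> simp

theorem Near.eventually {n : ℕ} {x : X} {P : (Fin n → X) → Prop} (h : Near n x P) :
    ∀ᶠ y in 𝓝 x, Near n y P := by
  cases n with
  | zero => exact Filter.Eventually.of_forall fun y => h
  | succ n =>
    change ∀ᶠ y in 𝓝 x, _ at h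
    exact h.eventually_nhds

end near

section complex
variable (k : Type*) [CommRing k] (X : Type*) [TopologicalSpace X]

/-- The functions of `n + 1` points that define the zero section of `𝒢^{n+1} k_X`. -/
def null (n : ℕ) : Submodule k (Fn k X n) where
  carrier := {f | ∀ x, Near n x (fun t => f (Fin.cons x t) = 0)}
  add_mem' {f g} hf hg x := (hf x).mp <| (hg x).mono fun t h1 h2 => by simp [h1, h2]
  zero_mem' x := Near.of_forall fun t => rfl
  smul_mem' c f hf x := (hf x).mono fun t h => by simp [h]

/-- The differential `(δ f)(x₀, ..., x_{n+1}) = ∑ i, (-1)^i f (x₀, ..., x̂_i, ..., x_{n+1})`. -/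
def delta (n : ℕ) : Fn k X n →ₗ[k] Fn k X (n + 1) where
  toFun f x := ∑ i : Fin (n + 2), (-1) ^ (i : ℕ) * f (fun j => x (i.succAbove j))
  map_add' f g := by ext x; simp [mul_add, Finset.sum_add_distrib]
  map_smul' c f := by ext x; simp [Finset.mul_sum, mul_left_comm]

/-- Representatives of the cocycles of the complex `Fn / null`. -/
def cocycles (n : ℕ) : Submodule k (Fn k X n) := (null k X (n + 1)).comap (delta k X n)

/-- Representatives of the coboundaries of the complex `Fn / null`. -/
def coboundaries : (n : ℕ) → Submodule k (Fn k X n)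
  | 0 => null k X 0
  | n + 1 => null k X (n + 1) ⊔ LinearMap.range (delta k X n)

/-- The cohomology module `H^n(X, k)`: the `n`-th cohomology of the complex `Fn / null`. -/
def H (n : ℕ) : Type _ :=
  cocycles k X n ⧸ (coboundaries k X n).submoduleOf (cocycles k X n)

instance (n : ℕ) : AddCommGroup (H k X n) :=
  inferInstanceAs (AddCommGroup (_ ⧸ (coboundaries k X n).submoduleOf (cocycles k X n)))

instance (n : ℕ) : Module k (H k X n) :=
  inferInstanceAs (Module k (_ ⧸ (coboundaries k X n).submoduleOf (cocycles k X n)))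

/-- The class of a cocycle. -/
def H.mk (n : ℕ) : cocycles k X n →ₗ[k] H k X n := Submodule.mkQ _

end complex

section sequences
variable {k X : Type*}

/-- The value of a cochain on the first points of an infinite sequence. -/
def ev {n : ℕ} (f : Fn k X n) (s : ℕ → X) : k := f (fun i => s i)

theorem ev_ext {n : ℕ} {f g : Fn k X n} (h : ∀ s, ev f s = ev g s) : f = g := by
  ext x
  have := h (fun j => if hj : j < n + 1 then x ⟨j, hj⟩ else x 0)
  have e : (fun i : Fin (n + 1) => if hj : (i : ℕ) < n + 1 then x ⟨i, hj⟩ else x 0) = x := by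
    ext i
    rw [dif_pos i.2]
  simpa only [ev, e] using this

/-- Omit the term number `i` of a sequence. -/
def skip (i : ℕ) (s : ℕ → X) : ℕ → X := fun j => if j < i then s j else s (j + 1)

theorem ev_congr {n : ℕ} (f : Fn k X n) {s t : ℕ → X} (h : ∀ i, i ≤ n → s i = t i) :
    ev f s = ev f t := by
  unfold ev
  congr 1
  ext i
  exact h i (by omega)

end sequences

section calculus
variable {k : Type*} [CommRing k] {X : Type*}

/-- The cup product of cochains. -/
def cup {p q : ℕ} (f : Fn k X p) (g : Fn k X q) : Fn k X (p + q) := fun x =>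
  f (fun i => x ⟨i, by omega⟩) * g (fun j => x ⟨p + j, by omega⟩)

theorem ev_delta [TopologicalSpace X] {n : ℕ} (f : Fn k X n) (s : ℕ → X) :
    ev (delta k X n f) s = ∑ i ∈ Finset.range (n + 2), (-1) ^ i * ev f (skip i s) := by
  rw [Finset.sum_range]
  change ∑ i : Fin (n + 2), _ = _
  refine Finset.sum_congr rfl fun i _ => ?_
  unfold ev
  congr 2
  ext j
  simp only [skip, Fin.succAbove]
  by_cases h : (j : ℕ) < i
  · simp [h, Fin.lt_def]
  · simp [h, Fin.lt_def]

theorem ev_cup {p q : ℕ} (f : Fn k X p) (g : Fn k X q) (s : ℕ → X) :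
    ev (cup f g) s = ev f s * ev g (fun j => s (p + j)) := rfl

variable [TopologicalSpace X]

/-- The Leibniz rule. -/
theorem leibniz {p q : ℕ} (f : Fn k X p) (g : Fn k X q) (s : ℕ → X) :
    ev (delta k X (p + q) (cup f g)) s =
      ev (cup (delta k X p f) g) s + (-1) ^ p * ev (cup f (delta k X q g)) s := by
  simp only [ev_delta, ev_cup]
  rw [show p + q + 2 = (p + 1) + (q + 1) by ring, Finset.sum_range_add,
    Finset.sum_range_succ _ (p + 1), Finset.sum_range_succ' _ (q + 1)]
  have h1 : ∀ i ∈ Finset.range (p + 1), (-1 : k) ^ i * (ev f (skip i s) *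
      ev g (fun j => skip i s (p + j))) =
      ((-1) ^ i * ev f (skip i s)) * ev g (fun j => s (p + 1 + j)) := by
    intro i hi
    rw [mul_assoc]
    congr 2
    apply ev_congr
    intro j _
    have : ¬ (p + j < i) := by simp at hi; omega
    simp only [skip, this, if_false]
    congr 1; ring
  have h2 : ∀ i ∈ Finset.range (q + 1), (-1 : k) ^ (p + 1 + i) * (ev f (skip (p + 1 + i) s) *
      ev g (fun j => skip (p + 1 + i) s (p + j))) =
      (-1) ^ p * (ev f s * ((-1) ^ (i + 1) * ev g (skip (i + 1) (fun j => s (p + j))))) := by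
    intro i _
    have e1 : ev f (skip (p + 1 + i) s) = ev f s := by
      apply ev_congr
      intro j hj
      simp only [skip]
      rw [if_pos (by omega)]
    have e2 : ev g (fun j => skip (p + 1 + i) s (p + j)) =
        ev g (skip (i + 1) (fun j => s (p + j))) := by
      apply ev_congr
      intro j hj
      simp only [skip]
      by_cases h : j < i + 1
      · rw [if_pos (by omega), if_pos h]
      · rw [if_neg (by omega), if_neg h]; rfl
    rw [e1, e2]; ring
  rw [Finset.sum_congr rfl h1, Finset.sum_congr rfl h2, ← Finset.sum_mul, ← Finset.mul_sum,
    ← Finset.mul_sum, add_mul]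
  have e3 : ev f (skip (p + 1) s) = ev f s := by
    apply ev_congr
    intro j hj
    simp only [skip]
    rw [if_pos (by omega)]
  have e4 : ev g (skip 0 fun j => s (p + j)) = ev g (fun j => s (p + 1 + j)) := by
    apply ev_congr
    intro j hj
    simp only [skip, Nat.not_lt_zero, if_false]
    congr 1; ring
  rw [e3, e4]
  ring

theorem null_cast {m n : ℕ} (h : m = n) {f : Fn k X m} {g : Fn k X n}
    (hfg : ∀ s, ev f s = ev g s) (hf : f ∈ null k X m) : g ∈ null k X n := by
  subst h
  rwa [← ev_ext hfg]

theorem cup_null_left {p q : ℕ} {f : Fn k X p} (g : Fn k X q) (hf : f ∈ null k X p) :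
    cup f g ∈ null k X (p + q) := by
  have key : ∀ (p N : ℕ) (_ : p ≤ N) (x : X) (Q : (Fin p → X) → Prop), Near p x Q →
      Near N x (fun t => Q (fun i => t ⟨i, by omega⟩)) := by
    intro p
    induction p with
    | zero =>
      intro N hN x Q h
      refine Near.of_forall fun t => ?_
      change Q _ at h
      convert h
    | succ p ih =>
      intro N hN x Q h
      obtain ⟨N, rfl⟩ : ∃ N', N = N' + 1 := ⟨N - 1, by omega⟩
      change ∀ᶠ y in 𝓝 x, _ at h
      change ∀ᶠ y in 𝓝 x, _
      filter_upwards [h] with y hy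
      refine (ih N (by omega) y _ hy).mono fun t ht => ?_
      convert ht using 1
      ext i
      refine Fin.cases ?_ (fun j => ?_) i
      · rfl
      · rfl
  intro x
  refine (key p (p + q) (by omega) x _ (hf x)).mono fun t ht => ?_
  have : (fun i : Fin (p + 1) => (Fin.cons x t : Fin (p + q + 1) → X) ⟨i, by omega⟩) =
      Fin.cons x (fun i : Fin p => t ⟨i, by omega⟩) := by
    ext i
    refine Fin.cases ?_ (fun j => ?_) i
    · rfl
    · rfl
  simp only [cup, this, ht, zero_mul]

theorem cup_null_right {p q : ℕ} (f : Fn k X p) {g : Fn k X q} (hg : g ∈ null k X q) :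
    cup f g ∈ null k X (p + q) := by
  have key : ∀ (p N : ℕ) (h : N = p + q) (x : X),
      Near N x (fun t => g (fun j => (Fin.cons x t : Fin (N + 1) → X) ⟨p + j, by omega⟩) = 0) := by
    intro p
    induction p with
    | zero =>
      intro N h x
      obtain rfl : N = q := by omega
      refine (hg x).mono fun t ht => ?_
      convert ht using 4
      simp
    | succ p ih =>
      intro N h x
      obtain ⟨N, rfl⟩ : ∃ N', N = N' + 1 := ⟨N - 1, by omega⟩
      change ∀ᶠ y in 𝓝 x, _
      refine Filter.Eventually.of_forall fun y => (ih N (by omega) y).mono fun t ht => ?_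
      convert ht using 3 with j
      have : (⟨p + 1 + j, by omega⟩ : Fin (N + 1 + 1)) = Fin.succ ⟨p + j, by omega⟩ := by
        ext; simp; omega
      rw [this, Fin.cons_succ]
  intro x
  refine (key p (p + q) rfl x).mono fun t ht => ?_
  simp only [cup, ht, mul_zero]


theorem null_le_cocycles (n : ℕ) : null k X n ≤ cocycles k X n := by
  have key : ∀ (n : ℕ) (x : X) (Q : (Fin n → X) → Prop) (i : Fin (n + 1)), Near n x Q →
      Near (n + 1) x (fun t => Q (fun j => t (i.succAbove j))) := by
    intro n
    induction n with
    | zero =>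
      intro x Q i h
      refine Near.of_forall fun t => ?_
      change Q _ at h
      convert h
    | succ n ih =>
      intro x Q i h
      refine Fin.cases ?_ (fun i => ?_) i
      · simpa [Near] using h.eventually
      · change ∀ᶠ y in 𝓝 x, _ at h
        change ∀ᶠ y in 𝓝 x, _
        filter_upwards [h] with y hy
        refine (ih y _ i hy).mono fun t ht => ?_
        convert ht using 1
        ext j
        refine Fin.cases ?_ (fun j => ?_) j <;> simp
  have face : ∀ (n : ℕ) (f : Fn k X n) (_ : f ∈ null k X n) (i : Fin (n + 2)),
      (fun x : Fin (n + 2) → X => f (fun j => x (i.succAbove j))) ∈ null k X (n + 1) := by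
    intro n f hf i x
    refine Fin.cases ?_ (fun i => ?_) i
    · change ∀ᶠ y in 𝓝 x, _
      refine Filter.Eventually.of_forall fun y => (hf y).mono fun t ht => ?_
      simpa using ht
    · refine (key n x _ i (hf x)).mono fun t ht => ?_
      refine Eq.trans (congrArg f ?_) ht
      ext j
      refine Fin.cases ?_ (fun j => ?_) j <;> simp
  intro f hf
  have : delta k X n f =
      ∑ i : Fin (n + 2), (-1 : k) ^ (i : ℕ) • (fun x => f (fun j => x (i.succAbove j))) := by
    ext x; simp [delta]
  change delta k X n f ∈ null k X (n + 1)
  rw [this]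
  exact Submodule.sum_mem _ fun i _ => Submodule.smul_mem _ _ (face n f hf i)

theorem delta_delta (n : ℕ) (f : Fn k X n) : delta k X (n + 1) (delta k X n f) = 0 := by
  refine ev_ext fun s => ?_
  change _ = (0 : k)
  simp only [ev_delta, Finset.mul_sum]
  rw [← Finset.sum_product']
  refine Finset.sum_involution
    (fun a _ => if a.1 ≤ a.2 then (a.2 + 1, a.1) else (a.2, a.1 - 1)) ?_ ?_ ?_ ?_
  · rintro ⟨i, j⟩ _
    by_cases h : i ≤ j
    · have e : skip i (skip (j + 1) s) = skip j (skip i s) := by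
        funext r
        simp only [skip]
        grind
      simp only [h, if_true, e]
      ring
    · obtain ⟨i, rfl⟩ : ∃ i', i = i' + 1 := ⟨i - 1, by omega⟩
      have e : skip i (skip j s) = skip j (skip (i + 1) s) := by
        funext r
        simp only [skip]
        grind
      simp only [h, if_false, Nat.add_sub_cancel, e]
      ring
  · rintro ⟨i, j⟩ _ _
    by_cases h : i ≤ j <;> simp only [h, if_true, if_false, ne_eq, Prod.mk.injEq] <;> omega
  · rintro ⟨i, j⟩ hij
    simp only [Finset.mem_product, Finset.mem_range] at hij ⊢
    by_cases h : i ≤ j <;> simp only [h, if_true, if_false] <;> omega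
  · rintro ⟨i, j⟩ _
    by_cases h : i ≤ j
    · have : ¬ j + 1 ≤ i := by omega
      simp [h, this]
    · have : j ≤ i - 1 := by omega
      simp only [h, if_false, this, if_true, Prod.mk.injEq, and_true]
      omega

theorem coboundaries_le_cocycles (n : ℕ) : coboundaries k X n ≤ cocycles k X n := by
  cases n with
  | zero => exact null_le_cocycles 0
  | succ n =>
    refine sup_le (null_le_cocycles _) ?_
    rintro _ ⟨f, rfl⟩
    change delta k X (n + 1) (delta k X n f) ∈ null k X (n + 2)
    rw [delta_delta]
    exact Submodule.zero_mem _

theorem cup_cocycles {p q : ℕ} {f : Fn k X p} {g : Fn k X q} (hf : f ∈ cocycles k X p)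
    (hg : g ∈ cocycles k X q) : cup f g ∈ cocycles k X (p + q) := by
  have h1 := null_cast (n := p + q + 1) (by omega) (g := delta k X (p + q) (cup f g) -
    ((-1 : k) ^ p • cup f (delta k X q g) : Fn k X (p + (q + 1)))) (fun s => by
      have := leibniz f g s
      change _ = ev (delta k X (p + q) (cup f g)) s - (-1) ^ p * ev (cup f (delta k X q g)) s
      rw [this]; ring) (cup_null_left g hf)
  have h2 := Submodule.add_mem _ h1
    (Submodule.smul_mem _ ((-1 : k) ^ p) (cup_null_right f hg))
  change delta k X (p + q) (cup f g) ∈ null k X (p + q + 1)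
  convert h2 using 1
  exact (sub_add_cancel _ _).symm

theorem coboundaries_cast {m n : ℕ} (h : m = n) {f : Fn k X m} {g : Fn k X n}
    (hfg : ∀ s, ev f s = ev g s) (hf : f ∈ coboundaries k X m) : g ∈ coboundaries k X n := by
  subst h
  rwa [← ev_ext hfg]

theorem null_le_coboundaries (n : ℕ) : null k X n ≤ coboundaries k X n := by
  cases n with
  | zero => exact le_rfl
  | succ n => exact le_sup_left

theorem delta_mem_coboundaries {n : ℕ} (f : Fn k X n) :
    delta k X n f ∈ coboundaries k X (n + 1) :=
  Submodule.mem_sup_right ⟨f, rfl⟩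

theorem cup_coboundaries_left {p q : ℕ} {f : Fn k X p} {g : Fn k X q}
    (hf : f ∈ coboundaries k X p) (hg : g ∈ cocycles k X q) :
    cup f g ∈ coboundaries k X (p + q) := by
  cases p with
  | zero => exact null_le_coboundaries _ (cup_null_left g hf)
  | succ p =>
    obtain ⟨a, ha, b, ⟨h, rfl⟩, rfl⟩ := Submodule.mem_sup.1 hf
    have e1 : cup (a + delta k X p h) g = cup a g + cup (delta k X p h) g := by
      ext x; simp [cup, add_mul]
    rw [e1]
    refine Submodule.add_mem _ (null_le_coboundaries _ (cup_null_left g ha)) ?_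
    refine coboundaries_cast (m := p + q + 1) (by omega) (f := delta k X (p + q) (cup h g) -
      ((-1 : k) ^ p • cup h (delta k X q g) : Fn k X (p + (q + 1)))) (fun s => ?_) ?_
    · have := leibniz h g s
      change ev (delta k X (p + q) (cup h g)) s - (-1) ^ p * ev (cup h (delta k X q g)) s = _
      rw [this]; ring
    · exact Submodule.sub_mem _ (delta_mem_coboundaries _)
        (Submodule.smul_mem _ _ (null_le_coboundaries _ (cup_null_right h hg)))

theorem cup_coboundaries_right {p q : ℕ} {f : Fn k X p} {g : Fn k X q}
    (hf : f ∈ cocycles k X p) (hg : g ∈ coboundaries k X q) :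
    cup f g ∈ coboundaries k X (p + q) := by
  cases q with
  | zero => exact null_le_coboundaries _ (cup_null_right f hg)
  | succ q =>
    obtain ⟨a, ha, b, ⟨h, rfl⟩, rfl⟩ := Submodule.mem_sup.1 hg
    have e1 : cup f (a + delta k X q h) = cup f a + cup f (delta k X q h) := by
      ext x; simp [cup, mul_add]
    rw [e1]
    refine Submodule.add_mem _ (null_le_coboundaries _ (cup_null_right f ha)) ?_
    have h1 := coboundaries_cast (n := p + q + 1) (by omega) (f := cup (delta k X p f) h)
      (g := delta k X (p + q) (cup f h) -
        ((-1 : k) ^ p • cup f (delta k X q h) : Fn k X (p + (q + 1)))) (fun s => by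
      have := leibniz f h s
      change _ = ev (delta k X (p + q) (cup f h)) s - (-1) ^ p * ev (cup f (delta k X q h)) s
      rw [this]; ring) (null_le_coboundaries _ (cup_null_left h hf))
    have h2 := Submodule.smul_mem _ ((-1 : k) ^ p)
      (Submodule.sub_mem _ (delta_mem_coboundaries (cup f h)) h1)
    have e2 : cup f (delta k X q h) = (-1 : k) ^ p • (delta k X (p + q) (cup f h) -
        (delta k X (p + q) (cup f h) -
          ((-1 : k) ^ p • cup f (delta k X q h) : Fn k X (p + (q + 1))))) := by
      refine Eq.trans ?_ (congrArg (fun z => (-1 : k) ^ p • z) (sub_sub_cancel _ _).symm)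
      rw [smul_smul, ← mul_pow]
      simp
    exact e2 ▸ h2

/-- The cup product of cocycles. -/
def cupZ (p q : ℕ) : cocycles k X p →ₗ[k] cocycles k X q →ₗ[k] cocycles k X (p + q) :=
  LinearMap.mk₂ k (fun f g => ⟨cup f.1 g.1, cup_cocycles f.2 g.2⟩)
    (fun f f' g => Subtype.ext <| by ext x; simp [cup, add_mul])
    (fun c f g => Subtype.ext <| by ext x; simp [cup, mul_assoc])
    (fun f g g' => Subtype.ext <| by ext x; simp [cup, mul_add])
    (fun c f g => Subtype.ext <| by ext x; simp [cup, mul_left_comm])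

/-- The cup product `H^p(X, k) × H^q(X, k) → H^{p+q}(X, k)`. -/
def cupH (p q : ℕ) : H k X p →ₗ[k] H k X q →ₗ[k] H k X (p + q) :=
  LinearMap.flip <| Submodule.liftQ _
    (LinearMap.flip <| Submodule.liftQ _ ((cupZ p q).compr₂ (H.mk k X (p + q))) <| by
      intro f hf
      refine LinearMap.ext fun g => ?_
      exact (Submodule.Quotient.mk_eq_zero _).2 (cup_coboundaries_left hf g.2)) <| by
    intro g hg
    refine LinearMap.ext fun f => ?_
    obtain ⟨f, rfl⟩ := Submodule.mkQ_surjective _ f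
    exact (Submodule.Quotient.mk_eq_zero _).2 (cup_coboundaries_right f.2 hg)

theorem cupH_mk {p q : ℕ} (f : cocycles k X p) (g : cocycles k X q) :
    cupH p q (H.mk k X p f) (H.mk k X q g) = H.mk k X (p + q) (cupZ p q f g) := rfl

theorem H.mk_surjective {p : ℕ} (a : H k X p) : ∃ f, H.mk k X p f = a :=
  Submodule.mkQ_surjective _ a

theorem mk_cast {m n : ℕ} (h : m = n) (f : cocycles k X m) (g : cocycles k X n)
    (hfg : ∀ s, ev f.1 s = ev g.1 s) :
    (GradedMonoid.mk m (H.mk k X m f) : GradedMonoid (H k X)) =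
      GradedMonoid.mk n (H.mk k X n g) := by
  subst h
  rw [show f = g from Subtype.ext (ev_ext hfg)]

/-- Constant functions as cocycles of degree zero. -/
def constZ : k →ₗ[k] cocycles k X 0 where
  toFun c := ⟨fun _ => c, by
    have : delta k X 0 (fun _ => c) = 0 := by
      ext x; simp [delta, Fin.sum_univ_two]
    change delta k X 0 (fun _ => c) ∈ null k X 1
    rw [this]; exact Submodule.zero_mem _⟩
  map_add' a b := rfl
  map_smul' a b := rfl

instance : GradedMonoid.GMul (H k X) where
  mul a b := cupH _ _ a b

instance : GradedMonoid.GOne (H k X) where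
  one := H.mk k X 0 (constZ 1)

instance : DirectSum.GRing (H k X) where
  mul_zero a := map_zero _
  zero_mul b := by change cupH _ _ 0 b = 0; simp
  mul_add a b c := map_add _ _ _
  add_mul a b c := by change cupH _ _ (a + b) c = _; rw [map_add]; rfl
  one_mul := by
    rintro ⟨n, a⟩
    obtain ⟨f, rfl⟩ := H.mk_surjective a
    refine mk_cast (zero_add n) (cupZ 0 n (constZ 1) f) f fun s => ?_
    change 1 * ev f.1 (fun j => s (0 + j)) = _
    simp
  mul_one := by
    rintro ⟨n, a⟩
    obtain ⟨f, rfl⟩ := H.mk_surjective a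
    refine mk_cast (add_zero n) (cupZ n 0 f (constZ 1)) f fun s => ?_
    change ev f.1 s * 1 = _
    simp
  mul_assoc := by
    rintro ⟨m, a⟩ ⟨n, b⟩ ⟨r, c⟩
    obtain ⟨f, rfl⟩ := H.mk_surjective a
    obtain ⟨g, rfl⟩ := H.mk_surjective b
    obtain ⟨h, rfl⟩ := H.mk_surjective c
    refine mk_cast (add_assoc m n r) (cupZ _ _ (cupZ _ _ f g) h) (cupZ _ _ f (cupZ _ _ g h))
      fun s => ?_
    simp [cupZ, ev_cup, mul_assoc, add_assoc]
  natCast n := H.mk k X 0 (constZ n)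
  natCast_zero := by simp
  natCast_succ n := by simp only [Nat.cast_succ, map_add]; rfl
  intCast n := H.mk k X 0 (constZ n)
  intCast_ofNat n := by simp
  intCast_negSucc_ofNat n := by
    rw [← map_neg, ← map_neg]
    congr 2
    push_cast
    ring

instance : DirectSum.GAlgebra k (H k X) where
  toFun := ((H.mk k X 0).comp constZ).toAddMonoidHom
  map_one := rfl
  map_mul a b := mk_cast (zero_add 0).symm (constZ (a * b)) (cupZ 0 0 (constZ a) (constZ b))
    fun s => rfl
  commutes := by
    rintro c ⟨n, a⟩
    obtain ⟨f, rfl⟩ := H.mk_surjective a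
    refine mk_cast ((zero_add n).trans (add_zero n).symm) (cupZ 0 n (constZ c) f)
      (cupZ n 0 f (constZ c)) fun s => ?_
    change c * ev f.1 (fun j => s (0 + j)) = ev f.1 s * c
    simp [mul_comm]
  smul_def := by
    rintro c ⟨n, a⟩
    obtain ⟨f, rfl⟩ := H.mk_surjective a
    refine mk_cast (zero_add n).symm (c • f) (cupZ 0 n (constZ c) f) fun s => ?_
    change c * ev f.1 s = c * ev f.1 (fun j => s (0 + j))
    simp

end calculus

/-- The total cohomology `H^•(X, k) = ⨁ n, H^n(X, k)`, a graded `k`-algebra for the cup product. -/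
abbrev HH (k X : Type*) [CommRing k] [TopologicalSpace X] := ⨁ n, H k X n

section pullback
variable (k : Type*) [CommRing k] {X Y Z : Type*} [TopologicalSpace X] [TopologicalSpace Y]
  [TopologicalSpace Z]

/-- The pull-back of cochains along a map. -/
def pullFn (u : C(X, Y)) (n : ℕ) : Fn k Y n →ₗ[k] Fn k X n :=
  LinearMap.funLeft k k (fun x => u ∘ x)

variable {k}

theorem pullFn_null (u : C(X, Y)) {n : ℕ} {f : Fn k Y n} (hf : f ∈ null k Y n) :
    pullFn k u n f ∈ null k X n := by
  intro x
  refine (Near.comp u (hf (u x))).mono fun t ht => ?_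
  rw [← ht]
  change f _ = f _
  congr 1
  ext i
  refine Fin.cases ?_ (fun j => ?_) i <;> simp

theorem pullFn_delta (u : C(X, Y)) {n : ℕ} (f : Fn k Y n) :
    delta k X n (pullFn k u n f) = pullFn k u (n + 1) (delta k Y n f) := rfl

theorem pullFn_coboundaries (u : C(X, Y)) {n : ℕ} {f : Fn k Y n}
    (hf : f ∈ coboundaries k Y n) : pullFn k u n f ∈ coboundaries k X n := by
  cases n with
  | zero => exact pullFn_null u hf
  | succ n =>
    obtain ⟨a, ha, b, ⟨h, rfl⟩, rfl⟩ := Submodule.mem_sup.1 hf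
    rw [map_add]
    exact Submodule.add_mem _ (null_le_coboundaries _ (pullFn_null u ha))
      (Submodule.mem_sup_right ⟨pullFn k u n h, rfl⟩)

variable (k)

/-- The pull-back of cocycles. -/
def pullZ (u : C(X, Y)) (n : ℕ) : cocycles k Y n →ₗ[k] cocycles k X n :=
  (pullFn k u n).restrict fun f hf => by
    change delta k X n (pullFn k u n f) ∈ null k X (n + 1)
    rw [pullFn_delta]
    exact pullFn_null u hf

/-- The pull-back in degree `n`. -/
def pullH (u : C(X, Y)) (n : ℕ) : H k Y n →ₗ[k] H k X n :=
  Submodule.mapQ _ _ (pullZ k u n) fun _ hf => pullFn_coboundaries u hf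

/-- The pull-back `u^* : H^•(Y, k) → H^•(X, k)`. -/
def pull (u : C(X, Y)) : HH k Y →ₐ[k] HH k X :=
  DirectSum.toAlgebra k _ (fun n => (DirectSum.lof k ℕ (H k X) n).comp (pullH k u n)) rfl <| by
    intro i j a b
    obtain ⟨f, rfl⟩ := H.mk_surjective a
    obtain ⟨g, rfl⟩ := H.mk_surjective b
    change _ = DirectSum.of _ _ _ * DirectSum.of _ _ _
    rw [DirectSum.of_mul_of]
    rfl

theorem pull_lof (u : C(X, Y)) (n : ℕ) (a : H k Y n) :
    pull k u (DirectSum.of _ n a) = DirectSum.of _ n (pullH k u n a) :=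
  DirectSum.toAddMonoid_of _ _ _

theorem pull_comp (u : C(X, Y)) (v : C(Y, Z)) (a : HH k Z) :
    pull k u (pull k v a) = pull k (v.comp u) a := by
  induction a using DirectSum.induction_on with
  | zero => simp
  | add a b ha hb => simp [ha, hb]
  | of n a =>
    rw [pull_lof, pull_lof, pull_lof]
    obtain ⟨f, rfl⟩ := H.mk_surjective a
    rfl

end pullback

/-! ## Tensor products over a non-commutative ring -/

section relTensor
variable {k S A B : Type*} [CommRing k] [Ring S] [Ring A] [Ring B]
  [Algebra k S] [Algebra k A] [Algebra k B] (f : S →ₐ[k] A) (g : S →ₐ[k] B)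

/-- The relations `(a s) ⊗ b = a ⊗ (s b)`, where `s ∈ S` acts on `A` on the right through `f`
and on `B` on the left through `g`. -/
def relSub : Submodule k (A ⊗[k] B) :=
  Submodule.span k {z | ∃ (a : A) (s : S) (b : B), z = (a * f s) ⊗ₜ[k] b - a ⊗ₜ[k] (g s * b)}

/-- The tensor product `A ⊗_S B` of the right `S`-module `A` (through `f`) and the left `S`-module
`B` (through `g`). -/
def RelTensor : Type _ := (A ⊗[k] B) ⧸ relSub f g

namespace RelTensor

instance : AddCommGroup (RelTensor f g) := inferInstanceAs (AddCommGroup (_ ⧸ relSub f g))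

instance : Module k (RelTensor f g) := inferInstanceAs (Module k (_ ⧸ relSub f g))

/-- The quotient map `A ⊗_k B → A ⊗_S B`. -/
def mk : A ⊗[k] B →ₗ[k] RelTensor f g := (relSub f g).mkQ

/-- The pure tensor `a ⊗ b` in `A ⊗_S B`. -/
def tmul (a : A) (b : B) : RelTensor f g := mk f g (a ⊗ₜ[k] b)

variable {f g} in
theorem ext_hom {M : Type*} [AddCommMonoid M] [Module k M] {u v : RelTensor f g →ₗ[k] M}
    (h : ∀ a b, u (tmul f g a b) = v (tmul f g a b)) : u = v := by
  have e : u.comp (mk f g) = v.comp (mk f g) := TensorProduct.ext' h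
  refine LinearMap.ext fun t => ?_
  obtain ⟨z, rfl⟩ := Submodule.mkQ_surjective _ t
  exact LinearMap.congr_fun e z

/-- The left action `a' (a ⊗ b) = (a' a) ⊗ b` of `A` on `A ⊗_S B`. -/
def leftMul (c : A) : RelTensor f g →ₗ[k] RelTensor f g :=
  Submodule.mapQ _ _ (TensorProduct.map (LinearMap.mulLeft k c) LinearMap.id) <| by
    refine Submodule.span_le.2 ?_
    rintro _ ⟨a, s, b, rfl⟩
    refine Submodule.subset_span ⟨c * a, s, b, ?_⟩
    simp [mul_assoc]

/-- The right action `(a ⊗ b) b' = a ⊗ (b b')` of `B` on `A ⊗_S B`. -/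
def rightMul (c : B) : RelTensor f g →ₗ[k] RelTensor f g :=
  Submodule.mapQ _ _ (TensorProduct.map LinearMap.id (LinearMap.mulRight k c)) <| by
    refine Submodule.span_le.2 ?_
    rintro _ ⟨a, s, b, rfl⟩
    refine Submodule.subset_span ⟨a, s, b * c, ?_⟩
    simp [mul_assoc]

theorem leftMul_tmul (c a : A) (b : B) : leftMul f g c (tmul f g a b) = tmul f g (c * a) b := rfl

theorem rightMul_tmul (c : B) (a : A) (b : B) :
    rightMul f g c (tmul f g a b) = tmul f g a (b * c) := rfl

/-- The left `A`-module structure on `A ⊗_S B`. -/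
instance : Module A (RelTensor f g) where
  smul c t := leftMul f g c t
  one_smul t := LinearMap.congr_fun (ext_hom (u := leftMul f g 1) (v := LinearMap.id)
    fun a b => by simp [leftMul_tmul]) t
  mul_smul c d t := LinearMap.congr_fun (ext_hom (u := leftMul f g (c * d))
    (v := (leftMul f g c).comp (leftMul f g d))
    fun a b => by simp [leftMul_tmul, mul_assoc]) t
  smul_zero c := map_zero _
  smul_add c := map_add _
  add_smul c d t := LinearMap.congr_fun (ext_hom (u := leftMul f g (c + d))
    (v := leftMul f g c + leftMul f g d)
    fun a b => by
      rw [LinearMap.add_apply]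
      simp only [leftMul_tmul]
      simp [tmul, add_mul, TensorProduct.add_tmul]) t
  zero_smul t := LinearMap.congr_fun (ext_hom (u := leftMul f g 0) (v := 0)
    fun a b => by rw [leftMul_tmul]; simp [tmul]) t

/-- The right `B`-module structure on `A ⊗_S B`. -/
instance : Module Bᵐᵒᵖ (RelTensor f g) where
  smul c t := rightMul f g c.unop t
  one_smul t := LinearMap.congr_fun (ext_hom (u := rightMul f g 1) (v := LinearMap.id)
    fun a b => by simp [rightMul_tmul]) t
  mul_smul c d t := LinearMap.congr_fun (ext_hom (u := rightMul f g (d.unop * c.unop))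
    (v := (rightMul f g c.unop).comp (rightMul f g d.unop))
    fun a b => by simp [rightMul_tmul, mul_assoc]) t
  smul_zero c := map_zero _
  smul_add c := map_add _
  add_smul c d t := LinearMap.congr_fun (ext_hom (u := rightMul f g (c.unop + d.unop))
    (v := rightMul f g c.unop + rightMul f g d.unop)
    fun a b => by
      rw [LinearMap.add_apply]
      simp only [rightMul_tmul]
      simp [tmul, mul_add, TensorProduct.tmul_add]) t
  zero_smul t := LinearMap.congr_fun (ext_hom (u := rightMul f g 0) (v := 0)
    fun a b => by rw [rightMul_tmul]; simp [tmul]) t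

end RelTensor

end relTensor

/-! ## Group actions, quotients and twisted projections -/

section actions
open MulOpposite

/-- The quotient `Γ \ X` by a left action. -/
abbrev LQuot (Γ X : Type*) [Group Γ] [MulAction Γ X] := MulAction.orbitRel.Quotient Γ X

/-- The orbit `Γ x`. -/
def LQuot.mk (Γ : Type*) {X : Type*} [Group Γ] [MulAction Γ X] (x : X) : LQuot Γ X :=
  Quotient.mk (MulAction.orbitRel Γ X) x

theorem LQuot.mk_eq {Γ X : Type*} [Group Γ] [MulAction Γ X] (c : Γ) (x : X) :
    LQuot.mk Γ (c • x) = LQuot.mk Γ x := Quotient.sound ⟨c, rfl⟩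

theorem LQuot.isOpenQuotientMap_mk (Γ X : Type*) [Group Γ] [MulAction Γ X] [TopologicalSpace X]
    [ContinuousConstSMul Γ X] : IsOpenQuotientMap (LQuot.mk Γ : X → LQuot Γ X) :=
  MulAction.isOpenQuotientMap_quotientMk

/-- The quotient `X / R` by a right action (an action of the opposite group). -/
def RQuot (R X : Type*) [Group R] [MulAction Rᵐᵒᵖ X] := MulAction.orbitRel.Quotient Rᵐᵒᵖ X

namespace RQuot
variable (R : Type*) {X : Type*} [Group R] [MulAction Rᵐᵒᵖ X]

/-- The orbit `x R`. -/
def mk (x : X) : RQuot R X := Quotient.mk (MulAction.orbitRel Rᵐᵒᵖ X) x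

theorem mk_eq (c : R) (x : X) : mk R (op c • x) = mk R x := Quotient.sound ⟨op c, rfl⟩

instance [TopologicalSpace X] : TopologicalSpace (RQuot R X) :=
  inferInstanceAs (TopologicalSpace (Quotient (MulAction.orbitRel Rᵐᵒᵖ X)))

theorem isOpenQuotientMap_mk [TopologicalSpace X] [ContinuousConstSMul Rᵐᵒᵖ X] :
    IsOpenQuotientMap (mk R : X → RQuot R X) :=
  MulAction.isOpenQuotientMap_quotientMk

/-- The left action `l (x R) = (l x) R` on `X / R`. -/
instance {L : Type*} [Group L] [MulAction L X] [SMulCommClass L Rᵐᵒᵖ X] :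
    MulAction L (RQuot R X) where
  smul l := Quotient.map (fun x => l • x) <| by
    rintro _ x ⟨r, rfl⟩
    exact ⟨r, (smul_comm l r x).symm⟩
  one_smul := by rintro ⟨x⟩; exact congrArg (mk R) (one_smul L x)
  mul_smul a b := by rintro ⟨x⟩; exact congrArg (mk R) (mul_smul a b x)

end RQuot

/-- The Borel construction `X _Γ× E = Γ \ (X × E)`. -/
abbrev Borel (Γ X E : Type*) [Group Γ] [MulAction Γ X] [MulAction Γ E] := LQuot Γ (X × E)

/-- The quotient map `E → Γ \ E` is a principal `Γ`-bundle. -/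
def IsPrincipalBundle (Γ E : Type*) [Group Γ] [TopologicalSpace Γ] [TopologicalSpace E]
    [MulAction Γ E] : Prop :=
  ∀ b : LQuot Γ E, ∃ U : Set (LQuot Γ E), IsOpen U ∧ b ∈ U ∧
    ∃ h : Γ × U ≃ₜ (LQuot.mk Γ ⁻¹' U : Set E),
      (∀ c u, LQuot.mk Γ (h (c, u) : E) = u) ∧
      ∀ c d u, (h (c * d, u) : E) = c • (h (d, u) : E)

/-- The quotient map `E → Γ \ E` is a universal principal `Γ`-bundle. -/
def IsUniversalBundle (Γ E : Type*) [Group Γ] [TopologicalSpace Γ] [TopologicalSpace E]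
    [MulAction Γ E] : Prop :=
  IsPrincipalBundle Γ E ∧ ContractibleSpace E

section tripleAct
variable {G : Type*} [Group G] {R P Q : Subgroup G} (hR : R ≤ P) (hQ : Q ≤ P) {X Y : Type*}
  [MulAction (↥R)ᵐᵒᵖ X] [MulAction Q Y]

/-- The right action `(x, p, y) (r, q) = (x r, r⁻¹ p q, q⁻¹ y)` on `X × P × Y`. -/
def tripleAct (r : R) (q : Q) (z : X × P × Y) : X × P × Y :=
  (op r • z.1, (Subgroup.inclusion hR r)⁻¹ * z.2.1 * Subgroup.inclusion hQ q, q⁻¹ • z.2.2)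

theorem tripleAct_one (z : X × P × Y) : tripleAct hR hQ 1 1 z = z := by
  simp [tripleAct]

theorem tripleAct_tripleAct (r r' : R) (q q' : Q) (z : X × P × Y) :
    tripleAct hR hQ r' q' (tripleAct hR hQ r q z) = tripleAct hR hQ (r * r') (q * q') z := by
  simp [tripleAct, smul_smul, mul_assoc]

end tripleAct

variable {G : Type*} [Group G] [TopologicalSpace G] [IsTopologicalGroup G]

/-- A twisting map: an `L`-equivariant continuous map `X → G / R`. -/
structure TwistingMap (L R : Subgroup G) (X : Type*) [TopologicalSpace X] [MulAction L X] where
  /-- the underlying continuous map -/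
  map : C(X, G ⧸ R)
  map_smul : ∀ (l : L) (x : X), map (l • x) = (l : G) • map x

/-- An `R`-`L`-equivariant continuous map `X → G`. -/
structure BiequivariantMap (L R : Subgroup G) (X : Type*) [TopologicalSpace X] [MulAction L X]
    [MulAction (↥R)ᵐᵒᵖ X] where
  /-- the underlying continuous map -/
  map : C(X, G)
  map_smul : ∀ (l : L) (x : X), map (l • x) = l * map x
  map_op_smul : ∀ (r : R) (x : X), map (op r • x) = map x * r

section projections
variable (E : Type*) [TopologicalSpace E] [MulAction G E] [ContinuousSMul G E]

/-- The map `π : R \ E → P \ E` for `R ⊆ P`. -/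
def quotProj {R P : Subgroup G} (h : R ≤ P) : C(LQuot R E, LQuot P E) where
  toFun := Quotient.lift (fun e => LQuot.mk P e) <| by
    rintro _ e ⟨r, rfl⟩
    exact LQuot.mk_eq (Subgroup.inclusion h r) e
  continuous_toFun := (LQuot.isOpenQuotientMap_mk P E).continuous.quotient_lift _

/-- The map `(g R, e) ↦ R g⁻¹ e`, that is, `(c, e) ↦ c⁻¹ e`. -/
def cosetInvSMul (R : Subgroup G) : C((G ⧸ R) × E, LQuot R E) where
  toFun z := Quotient.liftOn z.1 (fun c : G => LQuot.mk R (c⁻¹ • z.2)) <| by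
    intro a b hab
    have hab' : a⁻¹ * b ∈ R := QuotientGroup.leftRel_apply.1 hab
    have := LQuot.mk_eq (⟨a⁻¹ * b, hab'⟩ : R) (b⁻¹ • z.2)
    rw [← this]
    congr 1
    rw [Subgroup.mk_smul, smul_smul]
    simp
  continuous_toFun := by
    refine ((QuotientGroup.isOpenQuotientMap_mk (N := R)).prodMap
      (IsOpenQuotientMap.id (X := E))).continuous_comp_iff.1 ?_
    refine (LQuot.isOpenQuotientMap_mk R E).continuous.comp
      (g := fun e : E => LQuot.mk R e) (f := fun z : G × E => z.1⁻¹ • z.2) ?_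
    fun_prop

variable {X : Type*} [TopologicalSpace X]

/-- The canonical projection `X _L× E → L \ E`. -/
def canProj (L : Subgroup G) (X : Type*) [TopologicalSpace X] [MulAction L X] :
    C(Borel L X E, LQuot L E) where
  toFun := Quotient.lift (fun z => LQuot.mk L z.2) <| by
    rintro _ z ⟨l, rfl⟩
    exact LQuot.mk_eq l z.2
  continuous_toFun :=
    ((LQuot.isOpenQuotientMap_mk L E).continuous.comp continuous_snd).quotient_lift _

variable {E} in
theorem cosetInvSMul_smul {L R : Subgroup G} (l : L) (c : G ⧸ R) (e : E) :
    cosetInvSMul E R ((l : G) • c, l • e) = cosetInvSMul E R (c, e) := by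
  induction c using QuotientGroup.induction_on with
  | H a =>
    change LQuot.mk R (((l : G) * a)⁻¹ • (l : G) • e) = LQuot.mk R (a⁻¹ • e)
    rw [smul_smul]
    simp

/-- The projection `v_A : X _L× E → R \ E`, `L (x, e) ↦ A(x)⁻¹ e`, twisted by `A`. -/
def twProj {L R : Subgroup G} [MulAction L X] (A : TwistingMap L R X) :
    C(Borel L X E, LQuot R E) where
  toFun := Quotient.lift (fun z => cosetInvSMul E R (A.map z.1, z.2)) <| by
    rintro _ z ⟨l, rfl⟩
    change cosetInvSMul E R (A.map (l • z.1), l • z.2) = _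
    rw [A.map_smul, cosetInvSMul_smul]
  continuous_toFun := Continuous.quotient_lift (by fun_prop) _

end projections

section tripleProduct
variable {L R P Q M : Subgroup G} (hR : R ≤ P) (hQ : Q ≤ P) {X Y : Type*}
  [MulAction L X] [MulAction (↥R)ᵐᵒᵖ X] [MulAction Q Y] [SMulCommClass L (↥R)ᵐᵒᵖ X]

/-- The equivalence relation `(x, p, y) ∼ (x r, r⁻¹ p q, q⁻¹ y)`. -/
def tripleSetoid (X Y : Type*) [MulAction (↥R)ᵐᵒᵖ X] [MulAction Q Y] :
    Setoid (X × P × Y) where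
  r z w := ∃ (r : R) (q : Q), w = tripleAct hR hQ r q z
  iseqv :=
    { refl := fun z => ⟨1, 1, (tripleAct_one hR hQ z).symm⟩
      symm := by
        rintro z _ ⟨r, q, rfl⟩
        exact ⟨r⁻¹, q⁻¹, by simp [tripleAct_tripleAct, tripleAct_one]⟩
      trans := by
        rintro z _ _ ⟨r, q, rfl⟩ ⟨r', q', rfl⟩
        exact ⟨r * r', q * q', tripleAct_tripleAct hR hQ r r' q q' z⟩ }

/-- The quotient product `X ×_R P ×_Q Y`. -/
def Triple (X Y : Type*) [MulAction (↥R)ᵐᵒᵖ X] [MulAction Q Y] : Type _ :=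
  Quotient (tripleSetoid hR hQ X Y)

namespace Triple

/-- The class `[x : p : y]` of `z = (x, p, y)`. -/
def mk (z : X × P × Y) : Triple hR hQ X Y := Quotient.mk (tripleSetoid hR hQ X Y) z

instance [TopologicalSpace X] [TopologicalSpace Y] : TopologicalSpace (Triple hR hQ X Y) :=
  inferInstanceAs (TopologicalSpace (Quotient (tripleSetoid hR hQ X Y)))

/-- The left action `l [x : p : y] = [l x : p : y]`. -/
instance : MulAction L (Triple hR hQ X Y) where
  smul l := Quotient.map (fun z => (l • z.1, z.2)) <| by
    rintro z _ ⟨r, q, rfl⟩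
    exact ⟨r, q, by simp [tripleAct, smul_comm]⟩
  one_smul := by
    rintro ⟨z⟩
    exact congrArg (mk hR hQ) (Prod.ext (one_smul L z.1) rfl)
  mul_smul a b := by
    rintro ⟨z⟩
    exact congrArg (mk hR hQ) (Prod.ext (mul_smul a b z.1) rfl)

variable [TopologicalSpace X] [TopologicalSpace Y]

theorem isOpenQuotientMap_mk [ContinuousConstSMul (↥R)ᵐᵒᵖ X] [ContinuousConstSMul Q Y] :
    IsOpenQuotientMap (mk hR hQ : X × P × Y → Triple hR hQ X Y) := by
  refine ⟨Quotient.mk_surjective, continuous_quotient_mk', fun U hU => ?_⟩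
  change IsOpen (mk hR hQ ⁻¹' (mk hR hQ '' U))
  have : mk hR hQ ⁻¹' (mk hR hQ '' U) = ⋃ (r : R) (q : Q), tripleAct hR hQ r q ⁻¹' U := by
    ext z
    simp only [Set.mem_preimage, Set.mem_image, Set.mem_iUnion]
    constructor
    · rintro ⟨w, hw, h⟩
      obtain ⟨r, q, rfl⟩ := Quotient.exact h.symm
      exact ⟨r, q, hw⟩
    · rintro ⟨r, q, h⟩
      exact ⟨_, h, (Quotient.sound ⟨r, q, rfl⟩ : mk hR hQ z = mk hR hQ _).symm⟩
  rw [this]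
  refine isOpen_iUnion fun r => isOpen_iUnion fun q => hU.preimage ?_
  unfold tripleAct
  fun_prop

end Triple

variable [TopologicalSpace X] [TopologicalSpace Y]

/-- The twisting map `A : X / R → G / R`, `x R ↦ α(x) R`. -/
def BiequivariantMap.quot (α : BiequivariantMap L R X) : TwistingMap L R (RQuot R X) where
  map :=
    { toFun := Quotient.lift (fun x => (α.map x : G ⧸ R)) <| by
        rintro _ x ⟨r, rfl⟩
        change ((α.map (op r.unop • x) : G) : G ⧸ R) = _
        rw [α.map_op_smul]
        exact QuotientGroup.mk_mul_of_mem _ r.unop.2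
      continuous_toFun := Continuous.quotient_lift (by fun_prop) _ }
  map_smul l := by
    rintro ⟨x⟩
    exact congrArg (QuotientGroup.mk (s := R)) (α.map_smul l x)

/-- The twisting map `α B : X ×_R P ×_Q Y → G / M`, `[x : p : y] ↦ α(x) p B(y)`. -/
def BiequivariantMap.mulTwist (α : BiequivariantMap L R X) (B : TwistingMap Q M Y) :
    TwistingMap L M (Triple hR hQ X Y) where
  map :=
    { toFun := Quotient.lift
        (fun z : X × P × Y => (α.map z.1 * (z.2.1 : G)) • B.map z.2.2) <| by
          rintro z _ ⟨r, q, rfl⟩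
          change _ = (α.map (op r • z.1) * (((Subgroup.inclusion hR r)⁻¹ * z.2.1 *
            Subgroup.inclusion hQ q : P) : G)) • B.map (q⁻¹ • z.2.2)
          rw [α.map_op_smul, B.map_smul, smul_smul]
          congr 1
          simp [mul_assoc]
      continuous_toFun := Continuous.quotient_lift (by fun_prop) _ }
  map_smul l := by
    rintro ⟨z⟩
    change (α.map (l • z.1) * (z.2.1 : G)) • B.map z.2.2 =
      (l : G) • ((α.map z.1 * (z.2.1 : G)) • B.map z.2.2)
    rw [α.map_smul, smul_smul, mul_assoc]

variable (E : Type*) [TopologicalSpace E] [MulAction G E] [ContinuousSMul G E]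
  [ContinuousConstSMul (↥R)ᵐᵒᵖ X] [ContinuousConstSMul Q Y]

/-- The second component `L ([x : p : y], e) ↦ Q (y, p⁻¹ α(x)⁻¹ e)` of `φ`. -/
def phiSnd (α : BiequivariantMap L R X) : C(Borel L (Triple hR hQ X Y) E, Borel Q Y E) where
  toFun := Quotient.lift
    (fun w : Triple hR hQ X Y × E => Quotient.liftOn w.1
      (fun z : X × P × Y =>
        (LQuot.mk Q (z.2.2, (z.2.1 : G)⁻¹ • (α.map z.1)⁻¹ • w.2) : Borel Q Y E)) <| by
        rintro z _ ⟨r, q, rfl⟩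
        change _ = LQuot.mk Q (q⁻¹ • z.2.2, (((Subgroup.inclusion hR r)⁻¹ * z.2.1 *
            Subgroup.inclusion hQ q : P) : G)⁻¹ • (α.map (op r • z.1))⁻¹ • w.2)
        rw [α.map_op_smul, ← LQuot.mk_eq q⁻¹]
        congr 1
        refine Prod.ext rfl ?_
        change ((q⁻¹ : Q) : G) • (z.2.1 : G)⁻¹ • (α.map z.1)⁻¹ • w.2 = _
        simp [smul_smul, mul_assoc]) <| by
    rintro _ ⟨z, e⟩ ⟨l, rfl⟩
    obtain ⟨z, rfl⟩ := Quotient.mk_surjective z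
    change LQuot.mk Q (z.2.2, (z.2.1 : G)⁻¹ • (α.map (l • z.1))⁻¹ • (l : G) • e) =
      LQuot.mk Q (z.2.2, (z.2.1 : G)⁻¹ • (α.map z.1)⁻¹ • e)
    rw [α.map_smul]
    simp [smul_smul]
  continuous_toFun := by
    refine Continuous.quotient_lift ?_ _
    refine ((Triple.isOpenQuotientMap_mk hR hQ (X := X) (Y := Y)).prodMap
      (IsOpenQuotientMap.id (X := E))).continuous_comp_iff.1 ?_
    refine (LQuot.isOpenQuotientMap_mk Q (Y × E)).continuous.comp
      (g := fun w : Y × E => LQuot.mk Q w)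
      (f := fun w : (X × P × Y) × E =>
        (w.1.2.2, (w.1.2.1 : G)⁻¹ • (α.map w.1.1)⁻¹ • w.2)) ?_
    fun_prop

/-- The first component `L ([x : p : y], e) ↦ L (x R, e)` of `φ`. -/
def phiFst : C(Borel L (Triple hR hQ X Y) E, Borel L (RQuot R X) E) where
  toFun := Quotient.lift
    (fun w : Triple hR hQ X Y × E => Quotient.liftOn w.1
      (fun z : X × P × Y => (LQuot.mk L (RQuot.mk R z.1, w.2) : Borel L (RQuot R X) E)) <| by
        rintro z _ ⟨r, q, rfl⟩
        change _ = LQuot.mk L (RQuot.mk R (op r • z.1), w.2)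
        rw [RQuot.mk_eq]) <| by
    rintro _ ⟨z, e⟩ ⟨l, rfl⟩
    obtain ⟨z, rfl⟩ := Quotient.mk_surjective z
    exact LQuot.mk_eq l (RQuot.mk R z.1, e)
  continuous_toFun := by
    refine Continuous.quotient_lift ?_ _
    refine ((Triple.isOpenQuotientMap_mk hR hQ (X := X) (Y := Y)).prodMap
      (IsOpenQuotientMap.id (X := E))).continuous_comp_iff.1 ?_
    refine Continuous.comp (g := fun w : RQuot R X × E => LQuot.mk L w)
      (f := fun w : (X × P × Y) × E => (RQuot.mk R w.1.1, w.2)) continuous_quotient_mk' ?_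
    exact ((RQuot.isOpenQuotientMap_mk R).continuous.comp (by fun_prop)).prodMk (by fun_prop)

/-- The map `φ : (X ×_R P ×_Q Y) _L× E → ((X / R) _L× E) × (Y _Q× E)`,
`L ([x : p : y], e) ↦ (L (x R, e), Q (y, p⁻¹ α(x)⁻¹ e))`. -/
def phi (α : BiequivariantMap L R X) :
    C(Borel L (Triple hR hQ X Y) E, Borel L (RQuot R X) E × Borel Q Y E) :=
  (phiFst hR hQ E).prodMk (phiSnd hR hQ E α)

theorem phi_comm (α : BiequivariantMap L R X) :
    (((quotProj E hR).comp (twProj E α.quot)).comp ContinuousMap.fst).comp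
      (phi hR hQ (Y := Y) E α) =
    (((quotProj E hQ).comp (canProj E Q Y)).comp ContinuousMap.snd).comp (phi hR hQ E α) := by
  ext w
  obtain ⟨⟨z, e⟩, rfl⟩ := Quotient.mk_surjective w
  obtain ⟨⟨x, p, y⟩, rfl⟩ := Quotient.mk_surjective z
  change LQuot.mk P ((α.map x)⁻¹ • e) = LQuot.mk P ((p : G)⁻¹ • (α.map x)⁻¹ • e)
  exact (LQuot.mk_eq p⁻¹ _).symm

/-! ## The tensor product morphism -/

variable (k : Type*) [CommRing k]

/-- The cross product `a ⊗ b ↦ pr₁^*(a) ∪ pr₂^*(b)`. -/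
def cross (Z W : Type*) [TopologicalSpace Z] [TopologicalSpace W] :
    HH k Z ⊗[k] HH k W →ₗ[k] HH k (Z × W) :=
  TensorProduct.lift ((LinearMap.mul k (HH k (Z × W))).compl₁₂
    (pull k (ContinuousMap.fst : C(Z × W, Z))).toLinearMap
    (pull k (ContinuousMap.snd : C(Z × W, W))).toLinearMap)

/-- The map `Θ = φ^* ∘ ×`. -/
def Theta (α : BiequivariantMap L R X) :
    HH k (Borel L (RQuot R X) E) ⊗[k] HH k (Borel Q Y E) →ₗ[k]
      HH k (Borel L (Triple hR hQ X Y) E) :=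
  (pull k (phi hR hQ E α)).toLinearMap ∘ₗ cross k _ _

/-- The ring homomorphism through which `H_P^•(pt)` acts on `H_L^•(X / R)` on the right: the
action is the action of `H_R^•(pt)` twisted by `A`, restricted along `π_R^*`. -/
def baseLeft (α : BiequivariantMap L R X) :
    HH k (LQuot P E) →ₐ[k] HH k (Borel L (RQuot R X) E) :=
  (pull k (twProj E α.quot)).comp (pull k (quotProj E hR))

/-- The ring homomorphism through which `H_P^•(pt)` acts on `H_Q^•(Y)` on the left: the
action is the canonical action of `H_Q^•(pt)`, restricted along `π_Q^*`. -/
def baseRight (Y : Type*) [TopologicalSpace Y] [MulAction Q Y] :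
    HH k (LQuot P E) →ₐ[k] HH k (Borel Q Y E) :=
  (pull k (canProj E Q Y)).comp (pull k (quotProj E hQ))

/-- The tensor product `H_L^•(X / R) ⊗_{H_P^•(pt)} H_Q^•(Y)`. -/
abbrev TensorHP (α : BiequivariantMap L R X) (Y : Type*) [TopologicalSpace Y] [MulAction Q Y] :=
  RelTensor (baseLeft hR E k α) (baseRight hQ E k Y)

/-- The pure tensor `m ⊗ n` in `H_L^•(X / R) ⊗_{H_P^•(pt)} H_Q^•(Y)`. -/
abbrev tens (α : BiequivariantMap L R X) (m : HH k (Borel L (RQuot R X) E))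
    (n : HH k (Borel Q Y E)) : TensorHP hR hQ E k α Y :=
  RelTensor.tmul (baseLeft hR E k α) (baseRight hQ E k Y) m n

theorem Theta_rel (α : BiequivariantMap L R X) :
    relSub (baseLeft hR E k α) (baseRight hQ E k Y) ≤ LinearMap.ker (Theta hR hQ E k α) := by
  refine Submodule.span_le.2 ?_
  rintro _ ⟨m, a, n, rfl⟩
  change Theta hR hQ E k α _ = 0
  rw [map_sub, sub_eq_zero]
  have h := congrArg (fun u => pull k u a) (phi_comm hR hQ (Y := Y) E α)
  simp only [← pull_comp] at h
  change pull k (phi hR hQ E α) (pull k ContinuousMap.fst (m * baseLeft hR E k α a) *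
    pull k ContinuousMap.snd n) = pull k (phi hR hQ E α) (pull k ContinuousMap.fst m *
    pull k ContinuousMap.snd (baseRight hQ E k Y a * n))
  simp only [map_mul, mul_assoc]
  congr 1
  exact congrArg (· * _) h

/-- The map `θ : H_L^•(X / R) ⊗_{H_P^•(pt)} H_Q^•(Y) → H_L^•(X ×_R P ×_Q Y)` induced by `Θ`. -/
def theta (α : BiequivariantMap L R X) :
    TensorHP hR hQ E k α Y →ₗ[k] HH k (Borel L (Triple hR hQ X Y) E) :=
  Submodule.liftQ _ (Theta hR hQ E k α) (Theta_rel hR hQ E k α)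

/-- The rule `(m ⊗ n)(m' ⊗ n') = (-1)^{ij} (m ∪ m') ⊗ (n ∪ n')` for `n` of degree `i` and `m'` of
degree `j`, for a biadditive multiplication `μ` on `H_L^•(X / R) ⊗_{H_P^•(pt)} H_Q^•(Y)`. -/
def SignRule (α : BiequivariantMap L R X)
    (μ : TensorHP hR hQ E k α Y →+ TensorHP hR hQ E k α Y →+ TensorHP hR hQ E k α Y) : Prop :=
  ∀ (i j : ℕ) (m : HH k (Borel L (RQuot R X) E)) (n : H k (Borel Q Y E) i)
    (m' : H k (Borel L (RQuot R X) E) j) (n' : HH k (Borel Q Y E)),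
    μ (tens hR hQ E k α m (DirectSum.of _ i n)) (tens hR hQ E k α (DirectSum.of _ j m') n') =
      (-1 : k) ^ (i * j) •
        tens hR hQ E k α (m * DirectSum.of _ j m') (DirectSum.of _ i n * n')

end tripleProduct

end actions

end SheafCoh

/-! Write `φ₁`, `φ₂` for the components `phiFst`, `phiSnd` of `phi`. Pull-backs are functorial ring
homomorphisms, so `θ(m ⊗ n) = φ₁^*(m) ∪ φ₂^*(n)` (`theta_tens`), and every claim about `θ` is a
claim about such products.

For the ring structure, one fact carries the weight: the cohomology ring is graded commutative. At
the level of cochains the cup product is not commutative; Steenrod's cup-one product is a homotopy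
between `f ∪ g` and `± g ∪ f` (`delta_cupOne`). Its coboundary also contains terms with `δf` and
`δg`. For cocycles these factors are only null, that is, zero germ by germ, and not zero as
functions; the terms are null because nullity survives inserting extra variables and multiplying by
any function (`null_comp_strictMono`, `null_mul_right`). Hence `of_mul_of_comm`.

Graded commutativity is then used twice. In the two factors, it makes the relations `(m a) ⊗ n = m ⊗
(a n)` stable under left and right multiplication in the graded tensor product, so the
multiplication descends to the quotient (`exists_relMul`); associativity and unit are inherited, and
uniqueness holds because homogeneous pure tensors generate additively. In the target, it
interchanges `φ₂^*(n)` and `φ₁^*(m')` with exactly the sign of the rule (`theta_mul_of_signRule`).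

The module statements follow from associativity and two identities of maps: `can ∘ φ₁ = can`, and
`v_B ∘ φ₂ = v_{αB}`, which is `B(y)⁻¹ p⁻¹ α(x)⁻¹ e = (α(x) p B(y))⁻¹ e`. -/

namespace SheafCoh

/-! ### Graded commutativity of the cup product, by way of the cup-one product -/

section graded_commutativity

/-- The combinatorial cancellation behind the coboundary formula for the cup-one product. -/
theorem cupOne_sum_rearrange {A : Type*} [CommRing A] (p m : ℕ) (a b c : ℕ → ℕ → A)
    (h1 : ∀ i < p, ∀ j ≤ i, c i j = a (i + 1) j)
    (h2 : ∀ i < p, ∀ t ≤ m, c i (i + 1 + t) = (-1) ^ i * b i (t + 1))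
    (h3 : ∀ i < p, ∀ u < p - i, c i (i + 1 + (m + 1) + u) = (-1) ^ m * a i (i + 2 + u))
    (h4 : ∀ i < p, a (i + 1) (i + 1) = -(-1) ^ i * b i 0)
    (h5 : ∀ i < p, b i (m + 2) = -((-1) ^ m * (-1) ^ i) * a i (i + 1)) :
    (-1) ^ m * ∑ i ∈ Finset.range p, (-1) ^ (i * m) * ∑ j ∈ Finset.range (p + m + 2), c i j =
      ∑ i ∈ Finset.range (p + 1), (-1) ^ (i * m) * ∑ j ∈ Finset.range (p + 2), a i j +
      ∑ i ∈ Finset.range p, (-1) ^ i * (-1) ^ m * (-1) ^ (i * m) *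
        ∑ t ∈ Finset.range (m + 3), b i t - a 0 0 - (-1) ^ (p * m) * a p (p + 1) := by
  have sq (n : ℕ) : ((-1 : A) ^ n) * (-1) ^ n = 1 := by rw [← mul_pow]; simp
  -- The faces of `f` are split at the two endpoints of the block of `g`: `j = i` and `j = i + 1`.
  -- The first half is then reindexed by `i + 1` and the second by `i`, which isolates the two
  -- uncancelled terms `a 0 0` and `a p (p + 1)`.
  have hA : ∀ i ∈ Finset.range (p + 1), (-1) ^ (i * m) * ∑ j ∈ Finset.range (p + 2), a i j =
      ((-1) ^ (i * m) * ∑ j ∈ Finset.range i, a i j + (-1) ^ (i * m) * a i i) +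
      ((-1) ^ (i * m) * a i (i + 1) +
        (-1) ^ (i * m) * ∑ u ∈ Finset.range (p - i), a i (i + 2 + u)) := by
    intro i hi
    have e : p + 2 = i + 2 + (p - i) := by simp at hi; omega
    rw [e, Finset.sum_range_add, Finset.sum_range_succ, Finset.sum_range_succ]
    ring
  rw [Finset.sum_congr rfl hA, Finset.sum_add_distrib,
    Finset.sum_range_succ' (fun i => (-1) ^ (i * m) * ∑ j ∈ Finset.range i, a i j +
      (-1) ^ (i * m) * a i i), Finset.sum_range_succ (fun i => (-1) ^ (i * m) * a i (i + 1) +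
        (-1) ^ (i * m) * ∑ u ∈ Finset.range (p - i), a i (i + 2 + u))]
  -- Among the `p + m + 2` faces, the first `i + 1` shift the block of `g`, the next `m + 1` omit an
  -- interior point of it, and the last `p - i` lie beyond it. The factor `(-1) ^ m` turns the
  -- weight of index `i` into that of index `i + 1`, as the first group requires; the extreme faces
  -- of `b i` cancel against `a (i + 1) (i + 1)` and `a i (i + 1)`.
  have hC : ∀ i ∈ Finset.range p, (-1) ^ m * ((-1) ^ (i * m) *
      ∑ j ∈ Finset.range (p + m + 2), c i j) =
      ((-1) ^ ((i + 1) * m) * ∑ j ∈ Finset.range (i + 1), a (i + 1) j +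
        (-1) ^ ((i + 1) * m) * a (i + 1) (i + 1)) +
      ((-1) ^ (i * m) * a i (i + 1) +
        (-1) ^ (i * m) * ∑ u ∈ Finset.range (p - i), a i (i + 2 + u)) +
      (-1) ^ i * (-1) ^ m * (-1) ^ (i * m) * ∑ t ∈ Finset.range (m + 3), b i t := by
    intro i hi
    have hi : i < p := by simpa using hi
    have e : p + m + 2 = i + 1 + (m + 1) + (p - i) := by omega
    have s1 : ∑ j ∈ Finset.range (i + 1), c i j = ∑ j ∈ Finset.range (i + 1), a (i + 1) j :=
      Finset.sum_congr rfl fun j hj => h1 i hi j (by simp at hj; omega)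
    have s2 : ∑ t ∈ Finset.range (m + 1), c i (i + 1 + t) =
        (-1) ^ i * ∑ t ∈ Finset.range (m + 1), b i (t + 1) := by
      rw [Finset.mul_sum]
      exact Finset.sum_congr rfl fun t ht => h2 i hi t (by simp at ht; omega)
    have s3 : ∑ u ∈ Finset.range (p - i), c i (i + 1 + (m + 1) + u) =
        (-1) ^ m * ∑ u ∈ Finset.range (p - i), a i (i + 2 + u) := by
      rw [Finset.mul_sum]
      exact Finset.sum_congr rfl fun t ht => h3 i hi t (by simpa using ht)
    rw [e, Finset.sum_range_add, Finset.sum_range_add, s1, s2, s3,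
      Finset.sum_range_succ _ (m + 2), Finset.sum_range_succ' _ (m + 1), h4 i hi, h5 i hi,
      add_mul, pow_add, one_mul]
    linear_combination (-1) ^ (i * m) *
      (∑ u ∈ Finset.range (p - i), a i (i + 2 + u)) * sq m +
      (-1) ^ (i * m) * a i (i + 1) * ((-1) ^ m * (-1) ^ m * sq i + sq m)
  rw [Finset.mul_sum, Finset.sum_congr rfl hC]
  simp only [Finset.sum_add_distrib, Nat.sub_self, Finset.range_zero, Finset.sum_empty, zero_mul,
    pow_zero]
  ring

variable {k : Type*} [CommRing k] {X : Type*}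

/-- Keep the terms up to the number `i` of a sequence and omit the next `m` terms. -/
def jump (i m : ℕ) (s : ℕ → X) : ℕ → X := fun r => if r ≤ i then s r else s (r + m)

/-- The cup-one product of cochains. -/
def cupOne {p m : ℕ} (f : Fn k X p) (g : Fn k X (m + 1)) : Fn k X (p + m) := fun x =>
  ∑ i : Fin p, (-1) ^ ((i : ℕ) * m) *
    (f (fun r => x ⟨if (r : ℕ) ≤ i then r else r + m, by split <;> omega⟩) *
      g (fun r => x ⟨i + r, by omega⟩))

theorem ev_cupOne {p m : ℕ} (f : Fn k X p) (g : Fn k X (m + 1)) (s : ℕ → X) :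
    ev (cupOne f g) s = ∑ i ∈ Finset.range p, (-1) ^ (i * m) *
      (ev f (jump i m s) * ev g (fun r => s (i + r))) := by
  rw [Finset.sum_range]
  change ∑ i : Fin p, _ = _
  refine Finset.sum_congr rfl fun i _ => ?_
  congr 2
  unfold ev jump
  congr 1
  ext r
  split <;> rfl

variable [TopologicalSpace X]

/-- The coboundary of the cup-one product. -/
theorem delta_cupOne {p m : ℕ} (f : Fn k X p) (g : Fn k X (m + 1)) (s : ℕ → X) :
    (-1) ^ m * ev (delta k X (p + m) (cupOne f g)) s =
      ∑ i ∈ Finset.range (p + 1), (-1) ^ (i * m) *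
        (ev (delta k X p f) (jump i m s) * ev g (fun r => s (i + r))) +
      ∑ i ∈ Finset.range p, (-1) ^ i * (-1) ^ m * (-1) ^ (i * m) *
        (ev f (jump i (m + 1) s) * ev (delta k X (m + 1) g) (fun r => s (i + r))) +
      ((-1) ^ (p * (m + 1)) * ev (cup f g) s - ev (cup g f) s) := by
  -- Here `a` lists the faces coming from `δf`, `b` those coming from `δg`, and `c` those of the
  -- cup-one product itself.
  have key := cupOne_sum_rearrange p m
    (fun i j => (-1) ^ j * (ev f (skip j (jump i m s)) * ev g (fun r => s (i + r))))
    (fun i t => (-1) ^ t * (ev f (jump i (m + 1) s) * ev g (skip t (fun r => s (i + r)))))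
    (fun i j => (-1) ^ j *
      (ev f (jump i m (skip j s)) * ev g (fun r => skip j s (i + r)))) ?_ ?_ ?_ ?_ ?_
  · simp only [ev_delta, ev_cupOne, Finset.mul_sum, Finset.sum_mul] at key ⊢
    rw [Finset.sum_comm]
    -- The two surviving faces: at `i = 0` all points of `f` come after the start of the block of
    -- `g`, which gives `g ∪ f`; at `i = p` they all come before its end, which gives `f ∪ g`.
    have e1 : ev f (skip 0 (jump 0 m s)) = ev f (fun j => s (m + 1 + j)) :=
      ev_congr _ fun r _ => by simp only [skip, jump]; grind
    have e2 : ev f (skip (p + 1) (jump p m s)) = ev f s :=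
      ev_congr _ fun r _ => by simp only [skip, jump]; grind
    simp only [e1, e2] at key
    rw [ev_cup, ev_cup]
    simp only [zero_add] at key
    refine Eq.trans (Eq.trans ?_ key) ?_
    · refine Finset.sum_congr rfl fun i _ => Finset.sum_congr rfl fun j _ => ?_
      ring
    · rw [add_sub_assoc, add_sub_assoc, sub_sub, add_assoc, ← add_sub_assoc]
      have e3 : ∀ u v : k, u - v = u + -v := fun u v => sub_eq_add_neg u v
      simp only [e3, add_assoc]
      congr 1
      · refine Finset.sum_congr rfl fun i _ => Finset.sum_congr rfl fun j _ => ?_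
        ring
      congr 1
      · refine Finset.sum_congr rfl fun i _ => Finset.sum_congr rfl fun j _ => ?_
        ring
      ring
  · intro i hi j hj
    have e1 : ev f (jump i m (skip j s)) = ev f (skip j (jump (i + 1) m s)) :=
      ev_congr _ fun r _ => by simp only [skip, jump]; grind
    have e2 : ev g (fun r => skip j s (i + r)) = ev g (fun r => s (i + 1 + r)) :=
      ev_congr _ fun r _ => by simp only [skip]; grind
    simp only [e1, e2]
  · intro i hi t ht
    have e1 : ev f (jump i m (skip (i + 1 + t) s)) = ev f (jump i (m + 1) s) :=
      ev_congr _ fun r _ => by simp only [skip, jump]; grind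
    have e2 : ev g (fun r => skip (i + 1 + t) s (i + r)) =
        ev g (skip (t + 1) fun r => s (i + r)) :=
      ev_congr _ fun r _ => by simp only [skip]; grind
    simp only [e1, e2]
    ring
  · intro i hi u hu
    have e1 : ev f (jump i m (skip (i + 1 + (m + 1) + u) s)) =
        ev f (skip (i + 2 + u) (jump i m s)) :=
      ev_congr _ fun r _ => by simp only [skip, jump]; grind
    have e2 : ev g (fun r => skip (i + 1 + (m + 1) + u) s (i + r)) =
        ev g (fun r => s (i + r)) :=
      ev_congr _ fun r _ => by simp only [skip]; grind
    simp only [e1, e2]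
    ring
  · intro i hi
    have e1 : ev f (skip (i + 1) (jump (i + 1) m s)) = ev f (jump i (m + 1) s) :=
      ev_congr _ fun r _ => by simp only [skip, jump]; grind
    have e2 : ev g (skip 0 fun r => s (i + r)) = ev g (fun r => s (i + 1 + r)) :=
      ev_congr _ fun r _ => by simp only [skip]; grind
    simp only [e1, e2]
    ring
  · intro i hi
    have e1 : ev f (skip (i + 1) (jump i m s)) = ev f (jump i (m + 1) s) :=
      ev_congr _ fun r _ => by simp only [skip, jump]; grind
    have e2 : ev g (skip (m + 2) fun r => s (i + r)) = ev g (fun r => s (i + r)) :=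
      ev_congr _ fun r _ => by simp only [skip]; grind
    have sq : ((-1 : k) ^ i) * (-1) ^ i = 1 := by rw [← mul_pow]; simp
    simp only [e1, e2]
    linear_combination -(-1) ^ m * (ev f (jump i (m + 1) s) * ev g (fun r => s (i + r))) * sq

/-- Unused variables may be inserted anywhere in the chain: a dummy first variable only moves the
base point from `x` to a nearby `y`, and a condition valid near `x` is valid near every such `y`
(`Near.eventually`). Strict monotonicity of `θ` keeps the order of the chain. -/
theorem Near.comp_strictMono {n N : ℕ} {x : X} {Q : (Fin n → X) → Prop} (h : Near n x Q)
    {θ : Fin n → Fin N} (hθ : StrictMono θ) : Near N x (fun t => Q (t ∘ θ)) := by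
  induction N generalizing n x with
  | zero =>
    cases n with
    | zero =>
      change Q _ at h
      change Q _
      convert h
    | succ n => exact (θ 0).elim0
  | succ N ih =>
    cases n with
    | zero =>
      change Q _ at h
      refine Near.of_forall fun t => ?_
      convert h
    | succ n =>
      by_cases h0 : θ 0 = 0
      · have hne (j : Fin n) : θ j.succ ≠ 0 := by
          rw [← h0]; exact (hθ j.succ_pos).ne'
        change ∀ᶠ y in 𝓝 x, _ at h
        change ∀ᶠ y in 𝓝 x, _
        filter_upwards [h] with y hy
        refine (ih hy (θ := fun j => (θ j.succ).pred (hne j)) fun i j hij => ?_).mono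
          fun t ht => ?_
        · exact Fin.pred_lt_pred_iff.2 (hθ (Fin.succ_lt_succ_iff.2 hij))
        · convert ht using 1
          ext j
          refine Fin.cases ?_ (fun j => ?_) j
          · simp [h0]
          · obtain ⟨c, hc⟩ := Fin.exists_succ_eq.2 (hne j)
            simp [← hc]
      · have hne (j : Fin (n + 1)) : θ j ≠ 0 := fun hj =>
          h0 (le_antisymm ((hθ.monotone (Fin.zero_le j)).trans hj.le) (Fin.zero_le _))
        change ∀ᶠ y in 𝓝 x, _
        filter_upwards [h.eventually] with y hy
        refine (ih hy (θ := fun j => (θ j).pred (hne j)) fun i j hij => ?_).mono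
          fun t ht => ?_
        · exact Fin.pred_lt_pred_iff.2 (hθ hij)
        · convert ht using 1
          ext j
          obtain ⟨c, hc⟩ := Fin.exists_succ_eq.2 (hne j)
          simp [← hc]

/-- Used to see that `δf` and `δg`, evaluated on a selection of the points of a longer chain, remain
null. Compared with `Near.comp_strictMono`, the base point is now itself one of the points that `θ`
may omit. -/
theorem null_comp_strictMono {n N : ℕ} {f : Fn k X n} (hf : f ∈ null k X n)
    {θ : Fin (n + 1) → Fin (N + 1)} (hθ : StrictMono θ) :
    (fun x => f (x ∘ θ) : Fn k X N) ∈ null k X N := by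
  induction N with
  | zero =>
    obtain rfl : n = 0 := by
      have := Fintype.card_le_of_injective θ hθ.injective
      simpa using this
    have : θ = id := by ext i; omega
    simpa [this] using hf
  | succ N ih =>
    intro x
    by_cases h0 : θ 0 = 0
    · have hne (j : Fin n) : θ j.succ ≠ 0 := by
        rw [← h0]; exact (hθ j.succ_pos).ne'
      refine ((hf x).comp_strictMono (θ := fun j => (θ j.succ).pred (hne j))
        fun i j hij => ?_).mono fun t ht => ?_
      · exact Fin.pred_lt_pred_iff.2 (hθ (Fin.succ_lt_succ_iff.2 hij))
      · refine Eq.trans (congrArg f ?_) ht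
        ext j
        refine Fin.cases ?_ (fun j => ?_) j
        · simp [h0]
        · obtain ⟨c, hc⟩ := Fin.exists_succ_eq.2 (hne j)
          simp [← hc]
    -- The base point `x` is omitted. Nullity of `f` is a condition at every base point, so no
    -- nearness of `y` to `x` is needed.
    · have hne (j : Fin (n + 1)) : θ j ≠ 0 := fun hj =>
        h0 (le_antisymm ((hθ.monotone (Fin.zero_le j)).trans hj.le) (Fin.zero_le _))
      change ∀ᶠ y in 𝓝 x, _
      refine Filter.Eventually.of_forall fun y => (ih (θ := fun j => (θ j).pred (hne j))
        (fun i j hij => Fin.pred_lt_pred_iff.2 (hθ hij)) y).mono fun t ht => ?_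
      refine Eq.trans (congrArg f ?_) ht
      ext j
      obtain ⟨c, hc⟩ := Fin.exists_succ_eq.2 (hne j)
      simp [← hc]

theorem null_mul_right {n : ℕ} {f : Fn k X n} (hf : f ∈ null k X n) (h : Fn k X n) :
    f * h ∈ null k X n :=
  fun x => (hf x).mono fun t ht => by simp [ht]

/-- Graded commutativity of the cup product on cocycles. -/
theorem cup_comm_coboundaries {p m : ℕ} {f : Fn k X p} {g : Fn k X (m + 1)}
    (hf : f ∈ cocycles k X p) (hg : g ∈ cocycles k X (m + 1)) {h : Fn k X (p + (m + 1))}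
    (hh : ∀ s, ev h s = ev (cup g f) s) :
    (-1 : k) ^ (p * (m + 1)) • cup f g - h ∈ coboundaries k X (p + (m + 1)) := by
  -- `u` and `v` are the summands of `delta_cupOne` that contain `δf` and `δg`, written in the
  -- common degree `p + m + 1`. The coboundary factor stands first, so that `null_mul_right`
  -- applies.
  let u (i : ℕ) (hi : i ≤ p) : Fn k X (p + m + 1) := fun x =>
    delta k X p f (fun r => x ⟨if (r : ℕ) ≤ i then r else r + m, by split <;> omega⟩) *
      g (fun r => x ⟨i + r, by omega⟩)
  let v (i : ℕ) (hi : i < p) : Fn k X (p + m + 1) := fun x =>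
    delta k X (m + 1) g (fun r => x ⟨i + r, by omega⟩) *
      f (fun r => x ⟨if (r : ℕ) ≤ i then r else r + (m + 1), by split <;> omega⟩)
  have hu i hi : u i hi ∈ null k X (p + m + 1) := by
    refine null_mul_right (f := fun x => delta k X p f
      (fun r => x ⟨if (r : ℕ) ≤ i then r else r + m, by split <;> omega⟩))
      (null_comp_strictMono (θ := fun r => ⟨if (r : ℕ) ≤ i then r else r + m, by split <;> omega⟩)
        hf fun a b hab => ?_) _
    simp only [Fin.lt_def] at hab ⊢
    split <;> split <;> omega
  have hv i hi : v i hi ∈ null k X (p + m + 1) := by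
    refine null_mul_right (f := fun x => delta k X (m + 1) g (fun r => x ⟨i + r, by omega⟩))
      (null_comp_strictMono (θ := fun r => ⟨i + r, by omega⟩) hg fun a b hab => ?_) _
    simp only [Fin.lt_def] at hab ⊢
    omega
  have ev_u i hi s : ev (u i hi) s = ev (delta k X p f) (jump i m s) * ev g (fun r => s (i + r)) := by
    refine congrArg (fun w => delta k X p f w * ev g (fun r => s (i + r))) (funext fun r => ?_)
    unfold jump
    split <;> rfl
  have ev_v i hi s : ev (v i hi) s =
      ev f (jump i (m + 1) s) * ev (delta k X (m + 1) g) (fun r => s (i + r)) := by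
    rw [mul_comm]
    refine congrArg (fun w => ev (delta k X (m + 1) g) (fun r => s (i + r)) * f w)
      (funext fun r => ?_)
    unfold jump
    split <;> rfl
  -- `delta_cupOne` solved for the commutator: a coboundary minus null terms.
  refine coboundaries_cast (m := p + m + 1) rfl (f := (-1 : k) ^ m • delta k X (p + m) (cupOne f g) -
    ∑ i : Fin (p + 1), (-1 : k) ^ ((i : ℕ) * m) • u i (by omega) -
    ∑ i : Fin p, ((-1 : k) ^ (i : ℕ) * (-1) ^ m * (-1) ^ ((i : ℕ) * m)) • v i (by omega)) ?_ ?_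
  · intro s
    have key := delta_cupOne f g s
    rw [Finset.sum_range, Finset.sum_range] at key
    have e1 : ev ((-1 : k) ^ m • delta k X (p + m) (cupOne f g) -
        ∑ i : Fin (p + 1), (-1 : k) ^ ((i : ℕ) * m) • u i (by omega) -
        ∑ i : Fin p, ((-1 : k) ^ (i : ℕ) * (-1) ^ m * (-1) ^ ((i : ℕ) * m)) • v i (by omega)) s =
        (-1 : k) ^ m * ev (delta k X (p + m) (cupOne f g)) s -
        ∑ i : Fin (p + 1), (-1 : k) ^ ((i : ℕ) * m) * ev (u i (by omega)) s -
        ∑ i : Fin p, ((-1 : k) ^ (i : ℕ) * (-1) ^ m * (-1) ^ ((i : ℕ) * m)) *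
          ev (v i (by omega)) s := by
      simp [ev]
    have e2 : ev ((-1 : k) ^ (p * (m + 1)) • cup f g - h) s =
      (-1 : k) ^ (p * (m + 1)) * ev (cup f g) s - ev h s := rfl
    rw [e1, e2, hh, key]
    simp only [ev_u, ev_v]
    ring
  · refine Submodule.sub_mem _ (Submodule.sub_mem _
      (Submodule.smul_mem _ _ (delta_mem_coboundaries _)) ?_) ?_
    · exact Submodule.sum_mem _ fun i _ => Submodule.smul_mem _ _ (null_le_coboundaries _ (hu i (by omega)))
    · exact Submodule.sum_mem _ fun i _ => Submodule.smul_mem _ _ (null_le_coboundaries _ (hv i i.2))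

/-- The cup-one product lowers the total degree by one, so this argument takes the second class in
positive degree. -/
theorem of_mul_of_comm_succ {p m : ℕ} (a : H k X p) (b : H k X (m + 1)) :
    (DirectSum.of (H k X) (m + 1) b * DirectSum.of (H k X) p a : HH k X) =
      (-1 : k) ^ (p * (m + 1)) • (DirectSum.of (H k X) p a * DirectSum.of (H k X) (m + 1) b) := by
  obtain ⟨f, rfl⟩ := H.mk_surjective a
  obtain ⟨g, rfl⟩ := H.mk_surjective b
  rw [DirectSum.of_mul_of, DirectSum.of_mul_of]
  -- `g ∪ f` has degree `(m + 1) + p`; `h` is the same cochain reindexed to degree `p + (m + 1)`,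
  -- where it can be subtracted from `f ∪ g`.
  let h : Fn k X (p + (m + 1)) := fun x => cup g.1 f.1 (fun i => x ⟨i, by omega⟩)
  have hb := cup_comm_coboundaries f.2 g.2 (h := h) fun s => rfl
  have hc : h ∈ cocycles k X (p + (m + 1)) := by
    have := Submodule.sub_mem _ (Submodule.smul_mem _ ((-1 : k) ^ (p * (m + 1)))
      (cup_cocycles f.2 g.2)) (coboundaries_le_cocycles _ hb)
    rwa [sub_sub_cancel] at this
  have e1 : DirectSum.of (H k X) _ (GradedMonoid.GMul.mul (H.mk k X _ g) (H.mk k X _ f)) =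
      DirectSum.of (H k X) _ (H.mk k X (p + (m + 1)) ⟨h, hc⟩) :=
    DirectSum.of_eq_of_gradedMonoid_eq
      (mk_cast (by omega) (cupZ _ _ g f) ⟨h, hc⟩ fun s => rfl)
  have e2 : H.mk k X (p + (m + 1)) ⟨h, hc⟩ = (-1 : k) ^ (p * (m + 1)) •
      H.mk k X (p + (m + 1)) (cupZ _ _ f g) := by
    rw [← map_smul]
    exact ((Submodule.Quotient.eq ((coboundaries k X _).submoduleOf (cocycles k X _))).2 hb).symm
  rw [e1, e2, ← DirectSum.lof_eq_of k, ← DirectSum.lof_eq_of k, map_smul]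
  rfl

/-- Graded commutativity of the cohomology ring. -/
theorem of_mul_of_comm {p q : ℕ} (a : H k X p) (b : H k X q) :
    (DirectSum.of (H k X) q b * DirectSum.of (H k X) p a : HH k X) =
      (-1 : k) ^ (p * q) • (DirectSum.of (H k X) p a * DirectSum.of (H k X) q b) := by
  rcases q with _ | q
  -- In degrees `0, 0` the cochains already commute, being functions of one point. If only `q`
  -- vanishes, the roles are exchanged; the sign is then trivial.
  · rcases p with _ | p
    · obtain ⟨f, rfl⟩ := H.mk_surjective a
      obtain ⟨g, rfl⟩ := H.mk_surjective b
      rw [DirectSum.of_mul_of, DirectSum.of_mul_of]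
      simp only [mul_zero, pow_zero, one_smul]
      refine DirectSum.of_eq_of_gradedMonoid_eq (mk_cast rfl (cupZ 0 0 g f) (cupZ 0 0 f g)
        fun s => ?_)
      simp [cupZ, ev_cup, mul_comm]
    · rw [of_mul_of_comm_succ b a]
      simp
  · exact of_mul_of_comm_succ a b

end graded_commutativity

/-! ### The graded multiplication on a tensor product over a graded ring -/

section gradedRelTensor

variable {k : Type*} [CommRing k] {𝒜 ℬ 𝒮 : ℕ → Type*}
  [∀ i, AddCommGroup (𝒜 i)] [∀ i, AddCommGroup (ℬ i)] [∀ i, AddCommGroup (𝒮 i)]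
  [∀ i, Module k (𝒜 i)] [∀ i, Module k (ℬ i)] [∀ i, Module k (𝒮 i)]
  [GRing 𝒜] [GRing ℬ] [GRing 𝒮] [GAlgebra k 𝒜] [GAlgebra k ℬ] [GAlgebra k 𝒮]

/-- Graded commutativity of a graded algebra. -/
def IsGradedComm (k : Type*) [CommRing k] (𝒜 : ℕ → Type*) [∀ i, AddCommGroup (𝒜 i)]
    [∀ i, Module k (𝒜 i)] [GRing 𝒜] : Prop :=
  ∀ (p q : ℕ) (a : 𝒜 p) (b : 𝒜 q),
    (of 𝒜 q b * of 𝒜 p a : ⨁ i, 𝒜 i) = (-1 : k) ^ (p * q) • (of 𝒜 p a * of 𝒜 q b)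

/-- Rewrites the sign of `gradedMul`, a power of a unit of `ℤ` with exponent in the grading
semiring, as the scalar of `k` that occurs in `SignRule`. -/
theorem gradedMul_tmul_of_of_tmul (i j : ℕ) (m : ⨁ i, 𝒜 i) (n : ℬ i) (m' : 𝒜 j)
    (n' : ⨁ i, ℬ i) :
    gradedMul k 𝒜 ℬ (m ⊗ₜ of ℬ i n) (of 𝒜 j m' ⊗ₜ n') =
      (-1 : k) ^ (i * j) • ((m * of 𝒜 j m') ⊗ₜ (of ℬ i n * n')) := by
  refine (tmul_of_gradedMul_of_tmul k 𝒜 ℬ i j m n m' n').trans ?_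
  rw [Units.smul_def, ← Int.cast_smul_eq_zsmul k]
  congr 1
  have h := uzpow_natCast (R := ℕ) (-1 : ℤˣ) (i * j)
  rw [Nat.cast_id] at h
  rw [h]
  push_cast
  rfl

variable (f : (⨁ i, 𝒮 i) →ₐ[k] ⨁ i, 𝒜 i) (g : (⨁ i, 𝒮 i) →ₐ[k] ⨁ i, ℬ i)

theorem RelTensor.tmul_rel (a : ⨁ i, 𝒜 i) (s : ⨁ i, 𝒮 i) (b : ⨁ i, ℬ i) :
    RelTensor.mk f g ((a * f s) ⊗ₜ b) = RelTensor.mk f g (a ⊗ₜ (g s * b)) :=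
  (Submodule.Quotient.eq _).2 (Submodule.subset_span ⟨a, s, b, rfl⟩)

theorem RelTensor.smul_tmul (c a : ⨁ i, 𝒜 i) (b : ⨁ i, ℬ i) :
    c • RelTensor.tmul f g a b = RelTensor.tmul f g (c * a) b := rfl

theorem RelTensor.op_smul_tmul (c : ⨁ i, ℬ i) (a : ⨁ i, 𝒜 i) (b : ⨁ i, ℬ i) :
    MulOpposite.op c • RelTensor.tmul f g a b = RelTensor.tmul f g a (b * c) := rfl

variable (hA : IsGradedComm k 𝒜) (hB : IsGradedComm k ℬ)
  (hf : ∀ d s, ∃ a : 𝒜 d, f (of 𝒮 d s) = of 𝒜 d a)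
  (hg : ∀ d s, ∃ b : ℬ d, g (of 𝒮 d s) = of ℬ d b)

include hA hf hg in
-- For homogeneous `s`, `b`, `a'` of degrees `d`, `i`, `j`, the left side carries `(-1)^{ij}`, and
-- moving `f s` past `a'` to reach the tensor sign costs `(-1)^{jd}`. On the right side `g s * b`
-- has degree `d + i`, which gives `(-1)^{(d+i)j}` at once.
theorem mk_gradedMul_rel_left (a : ⨁ i, 𝒜 i) (s : ⨁ i, 𝒮 i) (b : ⨁ i, ℬ i)
    (y : (⨁ i, 𝒜 i) ⊗[k] (⨁ i, ℬ i)) :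
    RelTensor.mk f g (gradedMul k 𝒜 ℬ ((a * f s) ⊗ₜ b) y) =
      RelTensor.mk f g (gradedMul k 𝒜 ℬ (a ⊗ₜ (g s * b)) y) := by
  induction y using TensorProduct.induction_on with
  | zero => simp
  | add y z hy hz => simp only [map_add, hy, hz]
  | tmul a' b' =>
  induction a' using DirectSum.induction_on with
  | zero => simp
  | add y z hy hz => simp only [add_tmul, map_add, hy, hz]
  | of j a' =>
  induction b using DirectSum.induction_on with
  | zero => simp
  | add y z hy hz => simp only [mul_add, tmul_add, map_add, LinearMap.add_apply, hy, hz]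
  | of i b =>
  induction s using DirectSum.induction_on with
  | zero => simp
  | add y z hy hz =>
    simp only [mul_add, add_mul, tmul_add, add_tmul, map_add, LinearMap.add_apply, hy, hz]
  | of d s =>
  obtain ⟨u, hu⟩ := hf d s
  obtain ⟨v, hv⟩ := hg d s
  have e : (a * f (of 𝒮 d s)) * of 𝒜 j a' =
      (-1 : k) ^ (j * d) • ((a * of 𝒜 j a') * f (of 𝒮 d s)) := by
    rw [hu, mul_assoc, mul_assoc, hA j d a' u, mul_smul_comm]
  -- `of_mul_of` fuses `g s * b` into one homogeneous element so that the sign formula applies; it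
  -- is undone afterwards.
  rw [gradedMul_tmul_of_of_tmul, e, ← smul_tmul', smul_smul, map_smul, RelTensor.tmul_rel, hv,
    of_mul_of, gradedMul_tmul_of_of_tmul, ← of_mul_of, map_smul, mul_assoc, ← pow_add]
  congr 2
  ring

include hB hf hg in
-- The mirror image: here `g s` has to pass `b'`, so graded commutativity of `ℬ` is what matters.
theorem mk_gradedMul_rel_right (x : (⨁ i, 𝒜 i) ⊗[k] (⨁ i, ℬ i)) (a : ⨁ i, 𝒜 i)
    (s : ⨁ i, 𝒮 i) (b : ⨁ i, ℬ i) :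
    RelTensor.mk f g (gradedMul k 𝒜 ℬ x ((a * f s) ⊗ₜ b)) =
      RelTensor.mk f g (gradedMul k 𝒜 ℬ x (a ⊗ₜ (g s * b))) := by
  induction x using TensorProduct.induction_on with
  | zero => simp
  | add y z hy hz => simp only [map_add, LinearMap.add_apply, hy, hz]
  | tmul a' b' =>
  induction b' using DirectSum.induction_on with
  | zero => simp
  | add y z hy hz => simp only [tmul_add, map_add, LinearMap.add_apply, hy, hz]
  | of i b' =>
  induction a using DirectSum.induction_on with
  | zero => simp
  | add y z hy hz => simp only [add_mul, add_tmul, map_add, hy, hz]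
  | of j a =>
  induction s using DirectSum.induction_on with
  | zero => simp
  | add y z hy hz =>
    simp only [mul_add, add_mul, tmul_add, add_tmul, map_add, hy, hz]
  | of d s =>
  obtain ⟨u, hu⟩ := hf d s
  obtain ⟨v, hv⟩ := hg d s
  have e : of ℬ i b' * (g (of 𝒮 d s) * b) =
      (-1 : k) ^ (d * i) • (g (of 𝒮 d s) * (of ℬ i b' * b)) := by
    rw [hv, ← mul_assoc, ← mul_assoc, hB d i v b', smul_mul_assoc]
  rw [gradedMul_tmul_of_of_tmul, e, tmul_smul, smul_smul, map_smul, hu,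
    of_mul_of, gradedMul_tmul_of_of_tmul, ← of_mul_of, ← mul_assoc, ← hu, map_smul,
    RelTensor.tmul_rel, ← pow_add]
  congr 2
  ring

include hA hB hf hg in
/-- The graded multiplication descends to the tensor product over a graded ring that acts
through graded commutative algebras. -/
theorem exists_relMul : ∃ μ : RelTensor f g →ₗ[k] RelTensor f g →ₗ[k] RelTensor f g,
    (∀ (i j : ℕ) (m : ⨁ i, 𝒜 i) (n : ℬ i) (m' : 𝒜 j) (n' : ⨁ i, ℬ i),
      μ (RelTensor.tmul f g m (of ℬ i n)) (RelTensor.tmul f g (of 𝒜 j m') n') =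
        (-1 : k) ^ (i * j) • RelTensor.tmul f g (m * of 𝒜 j m') (of ℬ i n * n')) ∧
    (∀ s t u, μ (μ s t) u = μ s (μ t u)) ∧
    (∀ t, μ (RelTensor.tmul f g 1 1) t = t) ∧ ∀ t, μ t (RelTensor.tmul f g 1 1) = t := by
  have h1 : relSub f g ≤
      LinearMap.ker ((gradedMul k 𝒜 ℬ).compr₂ (RelTensor.mk f g)).flip := by
    refine Submodule.span_le.2 ?_
    rintro _ ⟨a, s, b, rfl⟩
    refine LinearMap.ext fun x => ?_
    simpa [sub_eq_zero] using mk_gradedMul_rel_right f g hB hf hg x a s b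
  -- The product descends in its right factor first; `ν` takes that factor as its first argument,
  -- and flipping it lets the left factor descend in turn.
  let ν : RelTensor f g →ₗ[k] (⨁ i, 𝒜 i) ⊗[k] (⨁ i, ℬ i) →ₗ[k] RelTensor f g :=
    Submodule.liftQ _ _ h1
  have h2 : relSub f g ≤ LinearMap.ker ν.flip := by
    refine Submodule.span_le.2 ?_
    rintro _ ⟨a, s, b, rfl⟩
    refine LinearMap.ext fun y => ?_
    obtain ⟨y, rfl⟩ := Submodule.mkQ_surjective _ y
    change RelTensor.mk f g (gradedMul k 𝒜 ℬ ((a * f s) ⊗ₜ b - a ⊗ₜ (g s * b)) y) = 0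
    simpa [sub_eq_zero] using mk_gradedMul_rel_left f g hA hf hg a s b y
  obtain ⟨μ, hμ⟩ : ∃ μ : RelTensor f g →ₗ[k] RelTensor f g →ₗ[k] RelTensor f g,
      ∀ x y, μ (RelTensor.mk f g x) (RelTensor.mk f g y) =
        RelTensor.mk f g (gradedMul k 𝒜 ℬ x y) :=
    ⟨Submodule.liftQ _ ν.flip h2, fun x y => rfl⟩
  have surj (t : RelTensor f g) : ∃ x, RelTensor.mk f g x = t := Submodule.mkQ_surjective _ t
  refine ⟨μ, fun i j m n m' n' => ?_, fun s t u => ?_, fun t => ?_, fun t => ?_⟩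
  · simp only [RelTensor.tmul, hμ, gradedMul_tmul_of_of_tmul, map_smul]
  · obtain ⟨s, rfl⟩ := surj s
    obtain ⟨t, rfl⟩ := surj t
    obtain ⟨u, rfl⟩ := surj u
    rw [hμ, hμ, hμ, hμ, gradedMul_assoc]
  · obtain ⟨t, rfl⟩ := surj t
    exact (hμ _ _).trans (congrArg _ (one_gradedMul _ _ t))
  · obtain ⟨t, rfl⟩ := surj t
    exact (hμ _ _).trans (congrArg _ (gradedMul_one _ _ t))

end gradedRelTensor

theorem isGradedComm_H (k X : Type*) [CommRing k] [TopologicalSpace X] :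
    IsGradedComm k (H k X) :=
  fun _ _ a b => of_mul_of_comm a b

/-- Supplies the hypothesis that `baseLeft` and `baseRight` preserve degrees, both being composites
of two pull-backs. -/
theorem pull_pull_of {k X Y Z : Type*} [CommRing k] [TopologicalSpace X]
    [TopologicalSpace Y] [TopologicalSpace Z] (u : C(X, Y)) (v : C(Y, Z)) (d : ℕ) (s : H k Z d) :
    ∃ a : H k X d, ((pull k u).comp (pull k v)) (DirectSum.of _ d s) = DirectSum.of _ d a :=
  ⟨pullH k u d (pullH k v d s), by
    rw [AlgHom.comp_apply, pull_lof, pull_lof]⟩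

/-! ### Multiplicativity and linearity of `θ` -/

section theta

variable {k : Type*} [CommRing k] {G : Type*} [Group G] [TopologicalSpace G] [IsTopologicalGroup G]
  {L R P Q : Subgroup G} (hR : R ≤ P) (hQ : Q ≤ P)
  {X : Type*} [TopologicalSpace X] [MulAction L X]
  [MulAction (↥R)ᵐᵒᵖ X] [ContinuousConstSMul (↥R)ᵐᵒᵖ X] [SMulCommClass L (↥R)ᵐᵒᵖ X]
  {Y : Type*} [TopologicalSpace Y] [MulAction Q Y] [ContinuousConstSMul Q Y]
  (E : Type*) [TopologicalSpace E] [MulAction G E] [ContinuousSMul G E]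
  (α : BiequivariantMap L R X)

theorem theta_tens (m : HH k (Borel L (RQuot R X) E)) (n : HH k (Borel Q Y E)) :
    theta hR hQ E k α (tens hR hQ E k α m n) =
      pull k (phiFst hR hQ E) m * pull k (phiSnd hR hQ E α) n := by
  change pull k (phi hR hQ E α) (pull k ContinuousMap.fst m * pull k ContinuousMap.snd n) = _
  rw [map_mul, pull_comp, pull_comp]
  rfl

omit [ContinuousConstSMul (↥R)ᵐᵒᵖ X] [ContinuousConstSMul Q Y] in
-- Both factors are taken homogeneous because `SignRule` only speaks of homogeneous inner factors.
theorem TensorHP.induction_on {p : TensorHP hR hQ E k α Y → Prop} (t : TensorHP hR hQ E k α Y)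
    (zero : p 0) (add : ∀ s t, p s → p t → p (s + t))
    (tens : ∀ i j m n, p (tens hR hQ E k α (DirectSum.of _ i m) (DirectSum.of _ j n))) : p t := by
  obtain ⟨x, rfl⟩ := Submodule.mkQ_surjective _ t
  induction x using TensorProduct.induction_on with
  | zero => exact zero
  | add x y hx hy => rw [map_add]; exact add _ _ hx hy
  | tmul a b =>
  induction a using DirectSum.induction_on with
  | zero => rw [zero_tmul, map_zero]; exact zero
  | add x y hx hy => rw [add_tmul, map_add]; exact add _ _ hx hy
  | of i a =>
  induction b using DirectSum.induction_on with
  | zero => rw [tmul_zero, map_zero]; exact zero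
  | add x y hx hy => rw [tmul_add, map_add]; exact add _ _ hx hy
  | of j b => exact tens i j a b

theorem mul_mul_mul_of_mul_eq_smul {A : Type*} [Ring A] [Algebra k A] (c : k) (a b a' b' : A)
    (h : b * a' = c • (a' * b)) : a * b * (a' * b') = c • (a * a' * (b * b')) := by
  rw [mul_assoc, ← mul_assoc b, h, smul_mul_assoc, mul_smul_comm]
  simp only [mul_assoc]

theorem theta_mul_of_signRule
    {μ : TensorHP hR hQ E k α Y →+ TensorHP hR hQ E k α Y →+ TensorHP hR hQ E k α Y}
    (hμ : SignRule hR hQ E k α μ) (s t : TensorHP hR hQ E k α Y) :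
    theta hR hQ E k α (μ s t) = theta hR hQ E k α s * theta hR hQ E k α t := by
  induction s using TensorHP.induction_on with
  | zero => simp only [map_zero, AddMonoidHom.zero_apply, zero_mul]
  | add x y hx hy => simp only [map_add, AddMonoidHom.add_apply, add_mul, hx, hy]
  | tens a i m n =>
  induction t using TensorHP.induction_on with
  | zero => simp only [map_zero, mul_zero]
  | add x y hx hy => simp only [map_add, mul_add, hx, hy]
  | tens j b m' n' =>
  rw [hμ, map_smul, theta_tens, theta_tens, theta_tens, map_mul, map_mul]
  simp only [pull_lof]
  -- What remains is to interchange `φ₂^*(n)`, of degree `i`, with `φ₁^*(m')`, of degree `j`, in the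
  -- cohomology of the target.
  rw [mul_comm i j]
  refine (mul_mul_mul_of_mul_eq_smul _ _ _ _ _ ?_).symm
  exact of_mul_of_comm (pullH k (phiFst hR hQ E) j m') (pullH k (phiSnd hR hQ E α) i n)

omit [ContinuousConstSMul (↥R)ᵐᵒᵖ X] [ContinuousConstSMul Q Y] in
theorem exists_tensorHP_mul :
    ∃ μ : TensorHP hR hQ E k α Y →+ TensorHP hR hQ E k α Y →+ TensorHP hR hQ E k α Y,
      SignRule hR hQ E k α μ ∧ (∀ s t u, μ (μ s t) u = μ s (μ t u)) ∧
      (∀ t, μ (tens hR hQ E k α 1 1) t = t) ∧ (∀ t, μ t (tens hR hQ E k α 1 1) = t) := by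
  obtain ⟨μ, h_sign, h_assoc, h_one, h_one'⟩ := exists_relMul (baseLeft hR E k α)
    (baseRight hQ E k Y) (isGradedComm_H k _) (isGradedComm_H k _) (pull_pull_of _ _)
    (pull_pull_of _ _)
  exact ⟨AddMonoidHom.mk' (fun s => (μ s).toAddMonoidHom) fun s t => by rw [map_add]; rfl,
    h_sign, h_assoc, h_one, h_one'⟩

omit [ContinuousConstSMul (↥R)ᵐᵒᵖ X] [ContinuousConstSMul Q Y] in
-- The rule prescribes the product of any two homogeneous pure tensors, and these generate the group
-- additively.
theorem SignRule.eq
    {μ ν : TensorHP hR hQ E k α Y →+ TensorHP hR hQ E k α Y →+ TensorHP hR hQ E k α Y}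
    (hμ : SignRule hR hQ E k α μ) (hν : SignRule hR hQ E k α ν) : ν = μ := by
  refine AddMonoidHom.ext fun s => AddMonoidHom.ext fun t => ?_
  induction s using TensorHP.induction_on with
  | zero => simp only [map_zero, AddMonoidHom.zero_apply]
  | add x y hx hy => simp only [map_add, AddMonoidHom.add_apply, hx, hy]
  | tens a i m n =>
  induction t using TensorHP.induction_on with
  | zero => simp only [map_zero]
  | add x y hx hy => simp only [map_add, hx, hy]
  | tens j b m' n' => rw [hμ, hν]

/-- Linearity over all of `H_L^•(X / R)`; the action of `H_L^•(pt)` is its restriction along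
`can^*`. -/
theorem theta_leftMul (c : HH k (Borel L (RQuot R X) E)) (t : TensorHP hR hQ E k α Y) :
    theta hR hQ E k α (c • t) = pull k (phiFst hR hQ E) c * theta hR hQ E k α t := by
  induction t using TensorHP.induction_on with
  | zero => simp only [smul_zero, map_zero, mul_zero]
  | add x y hx hy => simp only [smul_add, map_add, mul_add, hx, hy]
  | tens i j m n =>
    rw [RelTensor.smul_tmul, theta_tens, theta_tens, map_mul, mul_assoc]

theorem theta_rightMul (c : HH k (Borel Q Y E)) (t : TensorHP hR hQ E k α Y) :
    theta hR hQ E k α (MulOpposite.op c • t) =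
      theta hR hQ E k α t * pull k (phiSnd hR hQ E α) c := by
  induction t using TensorHP.induction_on with
  | zero => simp only [smul_zero, map_zero, zero_mul]
  | add x y hx hy => simp only [smul_add, map_add, add_mul, hx, hy]
  | tens i j m n =>
    rw [RelTensor.op_smul_tmul, theta_tens, theta_tens, map_mul, mul_assoc]

/-! ### Compatibility of the components of `φ` with the projections that define the actions -/

theorem canProj_comp_phiFst :
    (canProj E L (RQuot R X)).comp (phiFst hR hQ (Y := Y) E) =
      canProj E L (Triple hR hQ X Y) := by
  ext w
  obtain ⟨⟨z, e⟩, rfl⟩ := Quotient.mk_surjective w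
  obtain ⟨z, rfl⟩ := Quotient.mk_surjective z
  rfl

theorem cosetInvSMul_inv_smul {M : Subgroup G} (a : G) (c : G ⧸ M) (e : E) :
    cosetInvSMul E M (c, a⁻¹ • e) = cosetInvSMul E M (a • c, e) := by
  induction c using QuotientGroup.induction_on with
  | H b =>
    change LQuot.mk M (b⁻¹ • a⁻¹ • e) = LQuot.mk M ((a * b)⁻¹ • e)
    rw [smul_smul, mul_inv_rev]

/-- The element `p⁻¹ α(x)⁻¹` by which `phiSnd` moves `e` is absorbed into the coset, turning `B(y)`
into `α(x) p B(y)`. -/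
theorem twProj_comp_phiSnd {M : Subgroup G} (B : TwistingMap Q M Y) :
    (twProj E B).comp (phiSnd hR hQ E α) = twProj E (α.mulTwist hR hQ B) := by
  ext w
  obtain ⟨⟨z, e⟩, rfl⟩ := Quotient.mk_surjective w
  obtain ⟨⟨x, p, y⟩, rfl⟩ := Quotient.mk_surjective z
  change cosetInvSMul E M (B.map y, (p : G)⁻¹ • (α.map x)⁻¹ • e) =
    cosetInvSMul E M ((α.map x * (p : G)) • B.map y, e)
  rw [← cosetInvSMul_inv_smul, mul_inv_rev, mul_smul]

end theta
end SheafCoh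

/-! ### The theorem -/

open SheafCoh in
theorem mainTheorem5 {k : Type*} [CommRing k]
    {G : Type*} [Group G] [TopologicalSpace G] [IsTopologicalGroup G]
    {L R P Q : Subgroup G} (hR : R ≤ P) (hQ : Q ≤ P)
    {X : Type*} [TopologicalSpace X]
    [MulAction L X] [ContinuousSMul L X]
    [MulAction (↥R)ᵐᵒᵖ X] [ContinuousSMul (↥R)ᵐᵒᵖ X] [SMulCommClass L (↥R)ᵐᵒᵖ X]
    {Y : Type*} [TopologicalSpace Y] [MulAction Q Y] [ContinuousSMul Q Y]
    (α : BiequivariantMap L R X)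
    (E : Type*) [TopologicalSpace E] [MulAction G E] [ContinuousSMul G E]
    (hEL : IsUniversalBundle L E) (hER : IsUniversalBundle R E)
    (hEP : IsUniversalBundle P E) (hEQ : IsUniversalBundle Q E) :
    -- `θ` is a homomorphism for the ring structure `μ` given by the sign rule
    (∃ μ : TensorHP hR hQ E k α Y →+ TensorHP hR hQ E k α Y →+ TensorHP hR hQ E k α Y,
      SignRule hR hQ E k α μ ∧
      (∀ ν, SignRule hR hQ E k α ν → ν = μ) ∧
      (∀ s t u, μ (μ s t) u = μ s (μ t u)) ∧
      (∀ t, μ (tens hR hQ E k α 1 1) t = t) ∧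
      (∀ t, μ t (tens hR hQ E k α 1 1) = t) ∧
      (∀ s t, theta hR hQ E k α (μ s t) = theta hR hQ E k α s * theta hR hQ E k α t) ∧
      theta hR hQ E k α (tens hR hQ E k α 1 1) = (1 : HH k (Borel L (Triple hR hQ X Y) E))) ∧
    -- `θ` is a homomorphism of left `H_L^•(pt)`-modules for the canonical actions
    (∀ (a : HH k (LQuot L E)) (t : TensorHP hR hQ E k α Y),
      theta hR hQ E k α (pull k (canProj E L (RQuot R X)) a • t) =
        pull k (canProj E L (Triple hR hQ X Y)) a * theta hR hQ E k α t) ∧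
    -- `θ` is a homomorphism of right `H_M^•(pt)`-modules for the actions twisted by `B`, `α B`
    (∀ (M : Subgroup G), IsUniversalBundle M E → ∀ (B : TwistingMap Q M Y)
      (b : HH k (LQuot M E)) (t : TensorHP hR hQ E k α Y),
      theta hR hQ E k α (MulOpposite.op (pull k (twProj E B) b) • t) =
        theta hR hQ E k α t * pull k (twProj E (α.mulTwist hR hQ B)) b) := by
  obtain ⟨μ, hμ, h_assoc, h_one, h_one'⟩ := exists_tensorHP_mul (k := k) hR hQ (Y := Y) E α
  refine ⟨⟨μ, hμ, fun ν hν => hμ.eq hR hQ E α hν, h_assoc, h_one, h_one',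
    theta_mul_of_signRule hR hQ E α hμ, ?_⟩, fun a t => ?_, fun M _ B b t => ?_⟩
  · rw [theta_tens, map_one, map_one, mul_one]
  · rw [theta_leftMul, pull_comp, canProj_comp_phiFst]
  · rw [theta_rightMul, pull_comp, twProj_comp_phiSnd]
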